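/- All algebras are finite-dimensional over $\mathbb C$. A left-symmetric algebra (LSA) is an algebra $\mathfrak g$ whose associator satisfies $(x,y,z)=(y,x,z)$; then $[x,y]=xy-yx$ is a Lie bracket. Write $L(x)y=xy$. Let $G$ be the group of affine transformations of $\mathfrak g$ generated by the time-one flows of the affine vector fields $F_x(y)=xy+x$, $x\in\mathfrak g$. The LSA is *complete* if $G$ acts transitively on $\mathfrak g$, and *simple* if it is nonzero and has no two-sided ideals other than $0$ and $\mathfrak g$. A Cartan subalgebra $\mathfrak h$ of the Lie algebra $\mathfrak g$ defines a *canonical decomposition* if for every linear functional $\lambda$ on $\mathfrak h$ the root subspaces (generalized weight spaces) of $\lambda$ for the representations $\mathrm{ad}$ and $L$ of $\mathfrak h$ coincide, $\mathfrak h^\lambda=\mathfrak g^\lambda$; the decomposition is *one-dimensional* if $\dim\mathfrak g^\lambda\le 1$ for all $\lambda$. Let $\mathcal S_n$ be the class of simple complete LSAs of dimension $n$ that have a one-dimensional canonical decomposition. In the relations below, $e_\mu$ are basis vectors and products of basis vectors that are not listed are zero. 1. $\mathcal S_2$ is empty. 2. $\mathcal S_3$ consists, up to isomorphism, of exactly one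 algebra (Auslander's algebra): $$e_0e_1=e_1,\quad e_0e_{-1}=-e_{-1},\quad e_1e_{-1}=e_{-1}e_1=e_0 .$$ 3. $\mathcal S_4$ consists, up to isomorphism, of exactly one algebra: $$e_0e_{-1}=-e_{-1},\quad e_0e_1=e_1,\quad e_0e_2=2e_2,\quad e_{-1}e_1=e_1e_{-1}=e_0,\quad e_2e_{-1}=e_1,\quad e_{-1}e_2=2e_1 .$$ 4. In dimension 5 consider the following algebras. (a) For $\lambda\in\mathbb C\setminus\{0,1,-1\}$, the algebra $A_\lambda$ with basis $e_0,e_{\pm1},e_{\pm\lambda}$ and relations $$e_0e_{\pm1}=\pm e_{\pm1},\quad e_{-1}e_1=e_1e_{-1}=e_0,\quad e_0e_{\pm\lambda}=\pm\lambda e_{\pm\lambda},\quad e_{-\lambda}e_\lambda=e_\lambda e_{-\lambda}=e_0 .$$ (b) For $(\alpha,\beta,\gamma)\in\mathbb C^3\setminus\{0\}$ with $2\alpha=\beta+\gamma$, the algebra $B_{\alpha,\beta,\gamma}$ with basis $e_0,e_{\pm1},e_{\pm2}$, the relations of (a) for $\lambda=2$, and the additional relations $$e_2e_{-1}=\alpha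 e_1,\quad e_{-1}e_2=\beta e_1,\quad e_{-1}e_{-1}=\gamma e_{-2}.$$ (c) The algebra $C$ with basis $e_{-1},e_0,e_1,e_2,e_3$ and relations $$e_0e_k=ke_k,\quad e_{-1}e_k=ke_{k-1},\quad e_ke_{-1}=e_{k-1}\quad(k=1,2,3),\qquad e_0e_{-1}=-e_{-1}.$$ All of them belong to $\mathcal S_5$, and every algebra in $\mathcal S_5$ is isomorphic to one of them, where in (a) one may take $|\lambda|\ge1$. Moreover $A_\lambda\cong A_\mu$ if and only if $\mu\in\{\lambda,-\lambda,\lambda^{-1},-\lambda^{-1}\}$; $B_{\alpha,\beta,\gamma}\cong B_{\alpha',\beta',\gamma'}$ if and only if $(\alpha',\beta',\gamma')=c\,(\alpha,\beta,\gamma)$ for some $c\in\mathbb C\setminus\{0\}$, so that the isomorphism classes in (b) correspond to the points of a projective line; and no two algebras from different ones of the families (a), (b), (c) are isomorphic. -/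

import Mathlib

/-! ### Notions for left-symmetric algebras

A complex left-symmetric algebra is a type `A` with `[LeftPreLieRing A] [LeftPreLieAlgebra ℂ A]`:
the associator is symmetric in its first two arguments.  Mathlib equips such an `A` with the
commutator Lie bracket `⁅x, y⁆ = x * y - y * x`. -/

namespace LSA

section Notions

/-- `g` is the time-one flow of the affine vector field `F_x(y) = x y + x` on `A`: every `y` is
joined to `g y` by an integral curve `γ : ℝ → A` of `F_x`, over `[0, 1]`.  In the finite dimensional space
`A`, differentiability is tested against all linear functionals. -/
def IsTimeOneFlow {A : Type*} [LeftPreLieRing A] [LeftPreLieAlgebra ℂ A]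
    (x : A) (g : Equiv.Perm A) : Prop :=
  ∀ y : A, ∃ γ : ℝ → A, γ 0 = y ∧ γ 1 = g y ∧
    ∀ t : ℝ, ∀ φ : Module.Dual ℂ A,
      HasDerivAt (fun s : ℝ => φ (γ s)) (φ (x * γ t + x)) t

/-- The connected group of affine transformations of `A` whose Lie algebra is `{F_x | x ∈ A}`;
it is generated by the time-one flows of the fields `F_x`. -/
def affineGroup (A : Type*) [LeftPreLieRing A] [LeftPreLieAlgebra ℂ A] :
    Subgroup (Equiv.Perm A) :=
  Subgroup.closure {g | ∃ x : A, IsTimeOneFlow x g}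

/-- `A` is complete if the affine action of its group on `A` is transitive. -/
def IsComplete (A : Type*) [LeftPreLieRing A] [LeftPreLieAlgebra ℂ A] : Prop :=
  ∀ y z : A, ∃ g ∈ affineGroup A, g y = z

/-- A linear subspace `J` with `J A ⊆ J` and `A J ⊆ J`. -/
def IsIdeal {A : Type*} [LeftPreLieRing A] [LeftPreLieAlgebra ℂ A] (J : Submodule ℂ A) : Prop :=
  ∀ x ∈ J, ∀ y : A, x * y ∈ J ∧ y * x ∈ J

/-- `A` is simple: nonzero, with no two-sided ideals except `0` and `A`. -/
def IsSimple (A : Type*) [LeftPreLieRing A] [LeftPreLieAlgebra ℂ A] : Prop :=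
  Nontrivial A ∧ ∀ J : Submodule ℂ A, IsIdeal J → J = ⊥ ∨ J = ⊤

/-- The root subspace of the functional `χ` on `h` for the representation `ρ`, restricted to `h`:
all vectors that are annihilated, for every `x ∈ h`, by a power of `ρ x - χ x`. -/
def rootSubspace {A : Type*} [LeftPreLieRing A] [LeftPreLieAlgebra ℂ A]
    (ρ : A → Module.End ℂ A) (h : LieSubalgebra ℂ A) (χ : Module.Dual ℂ h) : Submodule ℂ A :=
  ⨅ x : h, (ρ (x : A)).maxGenEigenspace (χ x)

/-- The root subspace of `χ` for the adjoint representation. -/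
def adRootSubspace {A : Type*} [LeftPreLieRing A] [LeftPreLieAlgebra ℂ A]
    (h : LieSubalgebra ℂ A) (χ : Module.Dual ℂ h) : Submodule ℂ A :=
  rootSubspace (fun x => LieAlgebra.ad ℂ A x) h χ

/-- The root subspace of `χ` for the representation `L` by left multiplications. -/
def leftRootSubspace {A : Type*} [LeftPreLieRing A] [LeftPreLieAlgebra ℂ A]
    (h : LieSubalgebra ℂ A) (χ : Module.Dual ℂ h) : Submodule ℂ A :=
  rootSubspace (fun x => LinearMap.mulLeft ℂ x) h χ

/-- The Cartan subalgebra `h` defines a canonical decomposition: the root decompositions for `ad`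
and for `L` coincide. -/
def IsCanonical {A : Type*} [LeftPreLieRing A] [LeftPreLieAlgebra ℂ A]
    (h : LieSubalgebra ℂ A) : Prop :=
  h.IsCartanSubalgebra ∧ ∀ χ : Module.Dual ℂ h, adRootSubspace h χ = leftRootSubspace h χ

/-- `A` has a canonical decomposition all of whose root subspaces are at most one-dimensional. -/
def HasOneDimCanonicalDecomposition (A : Type*) [LeftPreLieRing A] [LeftPreLieAlgebra ℂ A] :
    Prop :=
  ∃ h : LieSubalgebra ℂ A, IsCanonical h ∧
    ∀ χ : Module.Dual ℂ h, Module.finrank ℂ (leftRootSubspace h χ) ≤ 1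

/-- The algebras to be classified. -/
structure IsSimpleCompleteOneDim (A : Type*) [LeftPreLieRing A] [LeftPreLieAlgebra ℂ A] :
    Prop where
  simple : IsSimple A
  complete : IsComplete A
  oneDim : HasOneDimCanonicalDecomposition A

/-- Isomorphism of left-symmetric algebras. -/
def Iso (A B : Type*) [LeftPreLieRing A] [LeftPreLieAlgebra ℂ A]
    [LeftPreLieRing B] [LeftPreLieAlgebra ℂ B] : Prop :=
  ∃ f : A ≃ₗ[ℂ] B, ∀ x y : A, f (x * y) = f x * f y

end Notions

/-! ### Algebras given by multiplication tables -/

section Tables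

/-- The bilinear product on `ℂⁿ` whose value on the basis vectors `e_i, e_j` is `T i j`. -/
def tableMul {n : ℕ} (T : Matrix (Fin n) (Fin n) (Fin n → ℂ)) (x y : Fin n → ℂ) : Fin n → ℂ :=
  ∑ i, ∑ j, (x i * y j) • T i j

/-- A multiplication table whose product is left-symmetric. -/
structure Table (n : ℕ) where
  prod : Matrix (Fin n) (Fin n) (Fin n → ℂ)
  leftSymm : ∀ x y z : Fin n → ℂ,
    tableMul prod (tableMul prod x y) z - tableMul prod x (tableMul prod y z) =
      tableMul prod (tableMul prod y x) z - tableMul prod y (tableMul prod x z)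

/-- The left-symmetric algebra with a given multiplication table. -/
def Table.Alg {n : ℕ} (_ : Table n) : Type := Fin n → ℂ

variable {n : ℕ} (T : Table n)

instance : AddCommGroup T.Alg := inferInstanceAs (AddCommGroup (Fin n → ℂ))

instance : Module ℂ T.Alg := inferInstanceAs (Module ℂ (Fin n → ℂ))

instance : FiniteDimensional ℂ T.Alg := inferInstanceAs (FiniteDimensional ℂ (Fin n → ℂ))

theorem tableMul_add (M : Matrix (Fin n) (Fin n) (Fin n → ℂ)) (x y z : Fin n → ℂ) :
    tableMul M x (y + z) = tableMul M x y + tableMul M x z := by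
  simp [tableMul, mul_add, add_smul, Finset.sum_add_distrib]

theorem add_tableMul (M : Matrix (Fin n) (Fin n) (Fin n → ℂ)) (x y z : Fin n → ℂ) :
    tableMul M (x + y) z = tableMul M x z + tableMul M y z := by
  simp [tableMul, add_mul, add_smul, Finset.sum_add_distrib]

theorem smul_tableMul (M : Matrix (Fin n) (Fin n) (Fin n → ℂ)) (r : ℂ) (x y : Fin n → ℂ) :
    tableMul M (r • x) y = r • tableMul M x y := by
  simp [tableMul, Finset.smul_sum, smul_smul, mul_assoc]

theorem tableMul_smul (M : Matrix (Fin n) (Fin n) (Fin n → ℂ)) (r : ℂ) (x y : Fin n → ℂ) :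
    tableMul M x (r • y) = r • tableMul M x y := by
  simp [tableMul, Finset.smul_sum, smul_smul, mul_left_comm]

theorem zero_tableMul (M : Matrix (Fin n) (Fin n) (Fin n → ℂ)) (x : Fin n → ℂ) :
    tableMul M 0 x = 0 := by
  simp [tableMul]

theorem tableMul_zero (M : Matrix (Fin n) (Fin n) (Fin n → ℂ)) (x : Fin n → ℂ) :
    tableMul M x 0 = 0 := by
  simp [tableMul]

instance : LeftPreLieRing T.Alg where
  mul x y := tableMul T.prod x y
  left_distrib x y z := tableMul_add T.prod x y z
  right_distrib x y z := add_tableMul T.prod x y z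
  zero_mul x := zero_tableMul T.prod x
  mul_zero x := tableMul_zero T.prod x
  assoc_symm' x y z := T.leftSymm x y z

instance : LeftPreLieAlgebra ℂ T.Alg where
  smul_assoc r x y := smul_tableMul T.prod r x y
  smul_comm r x y := (tableMul_smul T.prod r x y).symm

/-- The basis vectors of `ℂⁿ`. -/
def e {n : ℕ} (i : Fin n) : Fin n → ℂ := Pi.single i 1

end Tables

/-! ### The algebras of the classification -/

section Models

/-- Dimension 3 (Auslander's algebra). The rows and columns of the table, and the entries
`e 0, e 1, e 2`, correspond to `e_0, e_1, e_{-1}`. -/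
def auslander : Table 3 where
  prod := !![0,   e 1, -e 2;
             0,   0,   e 0;
             0,   e 0, 0]
  leftSymm x y z := by
    ext k
    fin_cases k <;> simp [tableMul, e, Fin.sum_univ_succ] <;> ring

/-- Dimension 4. The rows and columns of the table, and the entries `e 0, e 1, e 2, e 3`,
correspond to `e_0, e_{-1}, e_1, e_2`. -/
def dimFour : Table 4 where
  prod := !![0,   -e 1, e 2, (2 : ℂ) • e 3;
             0,   0,    e 0, (2 : ℂ) • e 2;
             0,   e 0,  0,   0;
             0,   e 2,  0,   0]
  leftSymm x y z := by
    ext k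
    fin_cases k <;> simp [tableMul, e, Fin.sum_univ_succ] <;> ring

/-- Dimension 5, roots `0, ±1, ±l`. The rows and columns of the table, and the entries
`e 0, e 1, e 2, e 3, e 4`, correspond to `e_0, e_1, e_{-1}, e_l, e_{-l}`. -/
def pairsProd (l α β γ : ℂ) : Matrix (Fin 5) (Fin 5) (Fin 5 → ℂ) :=
  !![0,   e 1, -e 2,    l • e 3, -(l • e 4);
     0,   0,   e 0,     0,       0;
     0,   e 0, γ • e 4, β • e 1, 0;
     0,   0,   α • e 1, 0,       e 0;
     0,   0,   0,       e 0,     0]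

theorem tableMul_pairsProd (l α β γ : ℂ) (x y : Fin 5 → ℂ) :
    tableMul (pairsProd l α β γ) x y =
      ![x 1 * y 2 + x 2 * y 1 + x 3 * y 4 + x 4 * y 3,
        x 0 * y 1 + β * (x 2 * y 3) + α * (x 3 * y 2),
        -(x 0 * y 2),
        l * (x 0 * y 3),
        -(l * (x 0 * y 4)) + γ * (x 2 * y 2)] := by
  ext k
  fin_cases k <;> simp [pairsProd, tableMul, e, Fin.sum_univ_five] <;> ring

/-- Dimension 5, two symmetric pairs of roots `±1`, `±l`, without additional relations. -/
def pairs (l : ℂ) : Table 5 where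
  prod := pairsProd l 0 0 0
  leftSymm x y z := by
    ext k
    fin_cases k <;> simp [tableMul_pairsProd] <;> ring

/-- Dimension 5, roots `0, ±1, ±2`, with the additional relations `e_2 e_{-1} = α e_1`,
`e_{-1} e_2 = β e_1`, `e_{-1} e_{-1} = γ e_{-2}`. -/
def pairsTwo (α β γ : ℂ) (h : 2 * α = β + γ) : Table 5 where
  prod := pairsProd 2 α β γ
  leftSymm x y z := by
    obtain rfl : γ = 2 * α - β := by rw [h]; ring
    ext k
    fin_cases k <;> simp [tableMul_pairsProd] <;> ring

/-- Dimension 5, roots `-1, 0, 1, 2, 3`. The rows and columns of the table, and the entries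
`e 0, e 1, e 2, e 3, e 4`, correspond to `e_0, e_{-1}, e_1, e_2, e_3`. -/
def chainProd : Matrix (Fin 5) (Fin 5) (Fin 5 → ℂ) :=
  !![0, -e 1, e 2, (2 : ℂ) • e 3, (3 : ℂ) • e 4;
     0, 0,    e 0, (2 : ℂ) • e 2, (3 : ℂ) • e 3;
     0, e 0,  0,   0,             0;
     0, e 2,  0,   0,             0;
     0, e 3,  0,   0,             0]

theorem tableMul_chainProd (x y : Fin 5 → ℂ) :
    tableMul chainProd x y =
      ![x 1 * y 2 + x 2 * y 1,
        -(x 0 * y 1),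
        x 0 * y 2 + 2 * (x 1 * y 3) + x 3 * y 1,
        2 * (x 0 * y 3) + 3 * (x 1 * y 4) + x 4 * y 1,
        3 * (x 0 * y 4)] := by
  ext k
  fin_cases k <;> simp [chainProd, tableMul, e, Fin.sum_univ_five] <;> ring

/-- The left-symmetric algebra of dimension 5 with roots `-1, 0, 1, 2, 3`. -/
def chain : Table 5 where
  prod := chainProd
  leftSymm x y z := by
    ext k
    fin_cases k <;> simp [tableMul_chainProd] <;> ring

end Models

end LSA

universe u

namespace LSA

section Eigenvectors

variable {A : Type*} [LeftPreLieRing A] [LeftPreLieAlgebra ℂ A]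

theorem linearIndependent_of_eigen {ι : Type*} {x : A} {v : ι → A} {w : ι → ℂ}
    (hw : Function.Injective w) (hv : ∀ i, v i ≠ 0) (hx : ∀ i, x * v i = w i • v i) :
    LinearIndependent ℂ v := by
  refine Module.End.eigenvectors_linearIndependent' (LinearMap.mulLeft ℂ x) w hw v fun i => ?_
  exact ⟨Module.End.mem_eigenspace_iff.2 (hx i), hv i⟩

end Eigenvectors

/-- `E` is a basis of `A`, indexed by the finite set `Λ` of weights of the operator of left
multiplication by `E 0` and extended by zero, for which `E 0` annihilates from the right;
`c` are the structure constants. -/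
structure Grading (A : Type*) [LeftPreLieRing A] [LeftPreLieAlgebra ℂ A]
    (Λ : Finset ℂ) (E : ℂ → A) (c : ℂ → ℂ → ℂ) : Prop where
  zero_mem : 0 ∈ Λ
  ne_zero : ∀ l ∈ Λ, E l ≠ 0
  eq_zero : ∀ l, l ∉ Λ → E l = 0
  left : ∀ l, E 0 * E l = l • E l
  right : ∀ l, E l * E 0 = 0
  card : Λ.card = Module.finrank ℂ A
  mul : ∀ l m, E l * E m = c l m • E (l + m)
  mem_left : ∀ l m, c l m ≠ 0 → l ∈ Λ
  mem_right : ∀ l m, c l m ≠ 0 → m ∈ Λ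
  mem_add : ∀ l m, c l m ≠ 0 → l + m ∈ Λ

theorem exists_structure_constants {A : Type*} [LeftPreLieRing A] [LeftPreLieAlgebra ℂ A]
    [FiniteDimensional ℂ A] {Λ : Finset ℂ} {E : ℂ → A}
    (zero_mem : 0 ∈ Λ) (ne_zero : ∀ l ∈ Λ, E l ≠ 0) (eq_zero : ∀ l, l ∉ Λ → E l = 0)
    (left : ∀ l, E 0 * E l = l • E l) (right : ∀ l, E l * E 0 = 0)
    (card : Λ.card = Module.finrank ℂ A) : ∃ c, Grading A Λ E c := by
  have hli : LinearIndependent ℂ (fun l : Λ => E l) :=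
    linearIndependent_of_eigen (w := fun l : Λ => (l : ℂ)) Subtype.val_injective
      (fun l => ne_zero l l.2) (fun l => left l)
  have : Nonempty Λ := ⟨⟨0, zero_mem⟩⟩
  let b := basisOfLinearIndependentOfCardEqFinrank hli (by simpa using card)
  have hb : ∀ l : Λ, b l = E l := fun l => by simp [b]
  have key : ∀ (k : ℂ) (v : A), E 0 * v = k • v → ∃ a : ℂ, v = a • E k ∧ (k ∉ Λ → a = 0) := by
    intro k v hv
    have hrepr : ∀ l : Λ, ((l : ℂ) - k) * b.repr v l = 0 := by
      have h1 : ∑ l : Λ, (((l : ℂ) - k) * b.repr v l) • b l = 0 := by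
        have h2 : E 0 * (∑ l : Λ, b.repr v l • b l) = k • ∑ l : Λ, b.repr v l • b l := by
          rw [b.sum_repr, hv]
        rw [Finset.mul_sum, Finset.smul_sum] at h2
        rw [← sub_eq_zero, ← Finset.sum_sub_distrib] at h2
        rw [← h2]
        refine Finset.sum_congr rfl fun l _ => ?_
        rw [mul_smul_comm, hb, left]
        module
      exact fun l => Fintype.linearIndependent_iff.1 b.linearIndependent _ h1 l
    have hz : ∀ l : Λ, (l : ℂ) ≠ k → b.repr v l = 0 := fun l hl =>
      (mul_eq_zero.1 (hrepr l)).resolve_left (sub_ne_zero.2 hl)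
    by_cases hk : k ∈ Λ
    · refine ⟨b.repr v ⟨k, hk⟩, ?_, fun h => absurd hk h⟩
      conv_lhs => rw [← b.sum_repr v]
      rw [Finset.sum_eq_single ⟨k, hk⟩, hb]
      · intro l _ hl
        rw [hz l (fun h => hl (Subtype.ext h)), zero_smul]
      · simp
    · refine ⟨0, ?_, fun _ => rfl⟩
      rw [zero_smul, ← b.sum_repr v]
      refine Finset.sum_eq_zero fun l _ => ?_
      rw [hz l (fun h => hk (h ▸ l.2)), zero_smul]
  have prod : ∀ l m, ∃ a : ℂ, E l * E m = a • E (l + m) ∧ (l + m ∉ Λ → a = 0) := by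
    intro l m
    refine key _ _ ?_
    have h := LeftPreLieRing.assoc_symm (E 0) (E l) (E m)
    simp only [associator_apply, left, right, zero_mul, mul_smul_comm, smul_mul_assoc] at h
    rw [add_smul, ← sub_eq_zero]
    rw [← sub_eq_zero] at h
    rw [← neg_eq_zero, ← h]
    abel
  choose c hc hc' using prod
  have hadd : ∀ l m, c l m ≠ 0 → l + m ∈ Λ := fun l m h => by_contra fun h' => h (hc' l m h')
  refine ⟨c, zero_mem, ne_zero, eq_zero, left, right, card, hc, ?_, ?_, hadd⟩
  · intro l m h
    by_contra hl
    have := hc l m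
    rw [eq_zero l hl, zero_mul, eq_comm, smul_eq_zero] at this
    exact this.elim h (ne_zero _ (hadd l m h))
  · intro l m h
    by_contra hl
    have := hc l m
    rw [eq_zero m hl, mul_zero, eq_comm, smul_eq_zero] at this
    exact this.elim h (ne_zero _ (hadd l m h))

theorem not_forall_add_mul_mem (Λ : Finset ℂ) {l : ℂ} (hl : l ≠ 0) (n : ℂ) :
    ¬ ∀ k : ℕ, n + (k + 1) * l ∈ Λ := by
  intro h
  refine Set.infinite_of_injective_forall_mem (s := (Λ : Set ℂ))
    (f := fun k : ℕ => n + ((k : ℂ) + 1) * l) ?_ (fun k => h k) Λ.finite_toSet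
  intro i j hij
  have := mul_right_cancel₀ hl (add_left_cancel hij)
  exact_mod_cast add_right_cancel this

theorem mem_image_const_mul (Λ : Finset ℂ) {k : ℂ} (hk : k ≠ 0) (l : ℂ) : l ∈ Λ.image (k * ·) ↔ l / k ∈ Λ := by
  rw [Finset.mem_image]
  constructor
  · rintro ⟨m, hm, rfl⟩
    rwa [mul_div_cancel_left₀ _ hk]
  · intro h
    exact ⟨_, h, mul_div_cancel₀ _ hk⟩

namespace Grading

variable {A : Type*} [LeftPreLieRing A] [LeftPreLieAlgebra ℂ A]
  {Λ : Finset ℂ} {E : ℂ → A} {c : ℂ → ℂ → ℂ} (G : Grading A Λ E c)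
include G

theorem const_zero_left {l : ℂ} (hl : l ∈ Λ) : c 0 l = l := by
  have h := G.mul 0 l
  rw [G.left, zero_add] at h
  exact (smul_left_injective ℂ (G.ne_zero l hl) h).symm

theorem const_zero_right (l : ℂ) : c l 0 = 0 := by
  by_contra h0
  have h := G.mul l 0
  rw [G.right, eq_comm, smul_eq_zero] at h
  exact h.elim h0 (G.ne_zero _ (G.mem_add l 0 h0))

theorem const_eq_zero_of_left {l : ℂ} (h : l ∉ Λ) (m : ℂ) : c l m = 0 :=
  by_contra fun h' => h (G.mem_left l m h')

theorem const_eq_zero_of_right {m : ℂ} (h : m ∉ Λ) (l : ℂ) : c l m = 0 :=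
  by_contra fun h' => h (G.mem_right l m h')

theorem const_eq_zero_of_add {l m : ℂ} (h : l + m ∉ Λ) : c l m = 0 :=
  by_contra fun h' => h (G.mem_add l m h')

theorem left_symm (l m n : ℂ) :
    c l m * c (l + m) n - c m n * c l (m + n) = c m l * c (l + m) n - c l n * c m (l + n) := by
  by_cases hs : l + m + n ∈ Λ
  · have h := LeftPreLieRing.assoc_symm (E l) (E m) (E n)
    simp only [associator_apply, G.mul, mul_smul_comm, smul_mul_assoc] at h
    rw [add_comm m l, ← add_assoc l m n, ← add_assoc m l n, add_comm m l] at h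
    refine smul_left_injective ℂ (G.ne_zero _ hs) ?_
    simp only [sub_smul, mul_smul]
    exact h
  · rw [G.const_eq_zero_of_add hs, G.const_eq_zero_of_add (l := l) (m := m + n) (by rwa [← add_assoc]),
      G.const_eq_zero_of_add (l := m) (m := l + n) (by rwa [← add_assoc, add_comm m l])]
    simp

theorem const_neg_comm (l : ℂ) : c l (-l) = c (-l) l := by
  by_contra hd
  have hl : l ≠ 0 := by
    rintro rfl
    simp at hd
  have hmem : l ∈ Λ := by
    by_contra h
    exact hd (by rw [G.const_eq_zero_of_left h, G.const_eq_zero_of_right h])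
  set d := c l (-l) - c (-l) l with hd'
  have hd0 : d ≠ 0 := sub_ne_zero.2 hd
  have key : ∀ k : ℕ, c l (k * l) * c (-l) ((k + 1) * l) = -d * l * (k * (k + 1) / 2) ∧
      0 + ((k : ℂ) + 1) * l ∈ Λ := by
    intro k
    induction k with
    | zero => simp [G.const_zero_right, hmem]
    | succ k ih =>
      obtain ⟨ih, hk⟩ := ih
      have h := G.left_symm l (-l) ((k + 1) * l)
      rw [add_neg_cancel, G.const_zero_left (by simpa using hk),
        show -l + ((k : ℂ) + 1) * l = k * l by ring,
        show l + ((k : ℂ) + 1) * l = (k + 1 + 1) * l by ring] at h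
      have h2 : c l ((k + 1) * l) * c (-l) ((k + 1 + 1) * l) =
          -d * l * ((k + 1) * (k + 1 + 1) / 2) := by
        rw [hd'] at ih ⊢
        linear_combination h + ih
      push_cast
      refine ⟨h2, ?_⟩
      have h3 : c l ((k + 1) * l) ≠ 0 := by
        intro h0
        rw [h0, zero_mul] at h2
        have h4 : ((k : ℂ) + 1) * (k + 1 + 1) / 2 ≠ 0 := by
          have h5 : ((k : ℂ) + 1) ≠ 0 := by exact_mod_cast k.succ_ne_zero
          have h6 : ((k : ℂ) + 1 + 1) ≠ 0 := by exact_mod_cast (k + 1).succ_ne_zero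
          exact div_ne_zero (mul_ne_zero h5 h6) two_ne_zero
        exact mul_ne_zero (mul_ne_zero (neg_ne_zero.2 hd0) hl) h4 h2.symm
      have h7 := G.mem_add _ _ h3
      rwa [show 0 + ((k : ℂ) + 1 + 1) * l = l + (k + 1) * l by ring]
  exact not_forall_add_mul_mem Λ hl 0 fun k => (key k).2

theorem const_mul_const_neg {l : ℂ} (hl : l ≠ 0) (n : ℂ) : c l n * c (-l) (l + n) = 0 := by
  by_contra h0
  have key : ∀ k : ℕ, c l (n + k * l) * c (-l) (l + (n + k * l)) = c l n * c (-l) (l + n) := by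
    intro k
    induction k with
    | zero => simp
    | succ k ih =>
      have h := G.left_symm l (-l) (n + (k + 1) * l)
      rw [G.const_neg_comm l, show -l + (n + ((k : ℂ) + 1) * l) = n + k * l by ring] at h
      rw [← ih, show l + (n + (k : ℂ) * l) = n + (k + 1) * l by ring]
      push_cast
      linear_combination h
  refine not_forall_add_mul_mem Λ hl n fun k => ?_
  have h := key k
  have h1 : c l (n + k * l) ≠ 0 := by
    intro h2
    rw [h2, zero_mul] at h
    exact h0 h.symm
  rw [show n + ((k : ℂ) + 1) * l = l + (n + k * l) by ring]
  exact G.mem_add _ _ h1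

/-- The product of two weight vectors whose weights are not paired with their opposites has a
weight of the same kind. -/
theorem const_mul_const_neg_add {m n : ℂ} (hm : c m (-m) = 0) (hn : c n (-n) = 0) :
    c m n * c (m + n) (-(m + n)) = 0 := by
  have h := G.left_symm m (-(m + n)) n
  rw [show m + -(m + n) = -n by ring, show -(m + n) + n = -m by ring, ← G.const_neg_comm n, hm, hn,
    ← G.const_neg_comm (m + n)] at h
  linear_combination h

theorem rescale {k : ℂ} (hk : k ≠ 0) :
    Grading A (Λ.image (k * ·)) (fun l => k • E (l / k)) (fun l m => k * c (l / k) (m / k)) := by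
  have hmem := mem_image_const_mul Λ hk
  refine ⟨?_, ?_, ?_, ?_, ?_, ?_, ?_, ?_, ?_, ?_⟩
  · simpa [hmem] using G.zero_mem
  · intro l hl
    exact smul_ne_zero hk (G.ne_zero _ ((hmem l).1 hl))
  · intro l hl
    rw [G.eq_zero _ (fun h => hl ((hmem l).2 h)), smul_zero]
  · intro l
    simp only [zero_div, smul_mul_smul_comm, G.left, smul_smul]
    congr 1
    field_simp
  · intro l
    simp [smul_mul_smul_comm, G.right]
  · rw [Finset.card_image_of_injective _ (mul_right_injective₀ hk), G.card]
  · intro l m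
    simp only [smul_mul_smul_comm, G.mul, smul_smul, add_div]
    congr 1
    ring
  · intro l m h
    exact (hmem l).2 (G.mem_left _ _ (right_ne_zero_of_mul h))
  · intro l m h
    exact (hmem m).2 (G.mem_right _ _ (right_ne_zero_of_mul h))
  · intro l m h
    rw [hmem, add_div]
    exact G.mem_add _ _ (right_ne_zero_of_mul h)

theorem linearIndependent : LinearIndependent ℂ (fun l : Λ => E l) :=
  linearIndependent_of_eigen (w := fun l : Λ => (l : ℂ)) Subtype.val_injective
    (fun l => G.ne_zero l l.2) (fun l => G.left l)

theorem span_eq_top : Submodule.span ℂ (Set.range E) = ⊤ := by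
  have : Nonempty Λ := ⟨⟨0, G.zero_mem⟩⟩
  have h := G.linearIndependent.span_eq_top_of_card_eq_finrank (by simpa using G.card)
  rw [eq_top_iff, ← h]
  refine Submodule.span_mono ?_
  rintro _ ⟨l, rfl⟩
  exact ⟨l, rfl⟩

/-- In a simple algebra one can leave every nonempty set of nonzero weights. -/
theorem exists_exit (hA : IsSimple A) {S : Finset ℂ} (hS : S ⊆ Λ) (hne : S.Nonempty)
    (h0 : 0 ∉ S) : ∃ s ∈ S, ∃ t, s + t ∉ S ∧ (c s t ≠ 0 ∨ c t s ≠ 0) := by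
  by_contra hcon
  push Not at hcon
  set J : Submodule ℂ A := Submodule.span ℂ (E '' S) with hJ
  have hmem : ∀ s ∈ S, E s ∈ J := fun s hs => Submodule.subset_span ⟨s, hs, rfl⟩
  have hid : IsIdeal J := by
    intro x hx y
    have hy : y ∈ Submodule.span ℂ (Set.range E) := G.span_eq_top ▸ Submodule.mem_top
    induction hx using Submodule.span_induction with
    | zero => simp
    | add a b _ _ ha hb =>
      rw [add_mul, mul_add]
      exact ⟨J.add_mem ha.1 hb.1, J.add_mem ha.2 hb.2⟩
    | smul r a _ ha =>
      rw [smul_mul_assoc, mul_smul_comm]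
      exact ⟨J.smul_mem r ha.1, J.smul_mem r ha.2⟩
    | mem x hx =>
      obtain ⟨s, hs, rfl⟩ := hx
      induction hy using Submodule.span_induction with
      | zero => simp
      | add a b _ _ ha hb =>
        rw [add_mul, mul_add]
        exact ⟨J.add_mem ha.1 hb.1, J.add_mem ha.2 hb.2⟩
      | smul r a _ ha =>
        rw [smul_mul_assoc, mul_smul_comm]
        exact ⟨J.smul_mem r ha.1, J.smul_mem r ha.2⟩
      | mem y hy =>
        obtain ⟨t, rfl⟩ := hy
        rw [G.mul, G.mul, add_comm t s]
        by_cases hst : s + t ∈ S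
        · exact ⟨J.smul_mem _ (hmem _ hst), J.smul_mem _ (hmem _ hst)⟩
        · rw [(hcon s hs t hst).1, (hcon s hs t hst).2]
          simp
  rcases hA.2 J hid with h | h
  · obtain ⟨s, hs⟩ := hne
    have := hmem s hs
    rw [h, Submodule.mem_bot] at this
    exact G.ne_zero s (hS hs) this
  · have h1 : E 0 ∉ J := by
      have h2 := G.linearIndependent.notMem_span_image (s := {l : Λ | (l : ℂ) ∈ S})
        (x := ⟨0, G.zero_mem⟩) (by simpa using h0)
      convert h2 using 2
      rw [hJ]
      congr 1
      ext x
      constructor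
      · rintro ⟨s, hs, rfl⟩
        exact ⟨⟨s, hS hs⟩, hs, rfl⟩
      · rintro ⟨s, hs, rfl⟩
        exact ⟨s, hs, rfl⟩
    exact h1 (h ▸ Submodule.mem_top)

end Grading

/-- An algebra with an eigenbasis that satisfies the relations of a table is isomorphic to the
algebra of the table. -/
theorem iso_of_eigenbasis {A : Type*} [LeftPreLieRing A] [LeftPreLieAlgebra ℂ A]
    {n : ℕ} [NeZero n] (T : Table n) {x : A} {w : Fin n → ℂ} {v : Fin n → A}
    (hn : Module.finrank ℂ A = n)
    (hw : Function.Injective w) (hv : ∀ i, v i ≠ 0) (hx : ∀ i, x * v i = w i • v i)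
    (hT : ∀ i j, v i * v j = ∑ k, T.prod i j k • v k) : Iso A T.Alg := by
  have : Nonempty (Fin n) := ⟨0⟩
  let b := basisOfLinearIndependentOfCardEqFinrank (linearIndependent_of_eigen hw hv hx)
    (by simpa using hn.symm)
  have hb : ∀ i, b i = v i := fun i => by simp [b]
  let f : (Fin n → ℂ) ≃ₗ[ℂ] A := b.equivFun.symm
  have hf : ∀ y, f y = ∑ i, y i • v i := fun y => by simp [f, hb, Module.Basis.equivFun_symm_apply]
  have hmul : ∀ y z, f (tableMul T.prod y z) = f y * f z := by
    intro y z
    rw [tableMul, map_sum, hf y, hf z, Finset.sum_mul]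
    refine Finset.sum_congr rfl fun i _ => ?_
    rw [map_sum, Finset.mul_sum]
    refine Finset.sum_congr rfl fun j _ => ?_
    rw [map_smul, smul_mul_smul_comm, hT, hf]
  refine ⟨f.symm, fun y z => ?_⟩
  apply f.injective
  change f (f.symm (y * z)) = f (tableMul T.prod (f.symm y) (f.symm z))
  rw [hmul]
  simp only [LinearEquiv.apply_symm_apply]

section CanonicalDecompositions

theorem mem_maxGenEigenspace_smul {V : Type*} [AddCommGroup V] [Module ℂ V] {f : Module.End ℂ V}
    {m : ℂ} {v : V} (hv : v ∈ f.maxGenEigenspace m) (a : ℂ) :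
    v ∈ (a • f).maxGenEigenspace (a * m) := by
  rw [Module.End.mem_maxGenEigenspace] at hv ⊢
  obtain ⟨k, hk⟩ := hv
  refine ⟨k, ?_⟩
  rw [show a • f - (a * m) • (1 : Module.End ℂ V) = a • (f - m • 1) by module, smul_pow,
    LinearMap.smul_apply, hk, smul_zero]

theorem apply_eq_smul_of_finrank_maxGenEigenspace_le_one {V : Type*} [AddCommGroup V] [Module ℂ V]
    [FiniteDimensional ℂ V] {f : Module.End ℂ V} {m : ℂ}
    (h : Module.finrank ℂ (f.maxGenEigenspace m) ≤ 1) {v : V} (hv : v ∈ f.maxGenEigenspace m) :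
    f v = m • v := by
  by_cases hv0 : v = 0
  · simp [hv0]
  have h1 : f.maxGenEigenspace m = f.eigenspace m := by
    refine (Submodule.eq_of_le_of_finrank_le Module.End.eigenspace_le_maxGenEigenspace
      (h.trans ?_)).symm
    rw [Nat.one_le_iff_ne_zero]
    intro h0
    rw [Submodule.finrank_eq_zero] at h0
    have h2 : f.maxGenEigenspace m ≠ ⊥ := fun h3 => hv0 (by rwa [h3, Submodule.mem_bot] at hv)
    have h3 : f.HasUnifEigenvalue m ⊤ := h2
    exact (h3.lt zero_lt_one) h0
  rw [h1] at hv
  exact Module.End.mem_eigenspace_iff.1 hv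

variable {A : Type*} [LeftPreLieRing A] [LeftPreLieAlgebra ℂ A]

theorem rootSubspace_eq_maxGenEigenspace {ρ : A → Module.End ℂ A}
    (hρ : ∀ (a : ℂ) y, ρ (a • y) = a • ρ y) {h : LieSubalgebra ℂ A} (x : h)
    (hx : ∀ y : h, ∃ a : ℂ, y = a • x) (χ : Module.Dual ℂ h) :
    rootSubspace ρ h χ = (ρ x).maxGenEigenspace (χ x) := by
  refine le_antisymm (iInf_le _ x) (le_iInf fun y => ?_)
  obtain ⟨a, rfl⟩ := hx y
  intro v hv
  rw [map_smul, smul_eq_mul, show ((a • x : h) : A) = a • (x : A) from rfl, hρ]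
  exact mem_maxGenEigenspace_smul hv a

theorem le_adRootSubspace_zero (h : LieSubalgebra ℂ A) [LieRing.IsNilpotent h] :
    h.toSubmodule ≤ adRootSubspace h 0 := by
  intro y hy
  refine (Submodule.mem_iInf _).2 fun x => ?_
  have h1 := LieAlgebra.le_zeroRootSubalgebra ℂ A h hy
  rw [LieAlgebra.mem_zeroRootSubalgebra] at h1
  rw [Module.End.mem_maxGenEigenspace]
  obtain ⟨k, hk⟩ := h1 x
  refine ⟨k, ?_⟩
  simp only [LinearMap.zero_apply, zero_smul, sub_zero]
  exact hk

theorem exists_grading [FiniteDimensional ℂ A] [Nontrivial A]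
    (hA : HasOneDimCanonicalDecomposition A) : ∃ Λ E c, Grading A Λ E c := by
  classical
  obtain ⟨h, ⟨hC, heq⟩, hdim⟩ := hA
  have hnil := hC.nilpotent
  have hne : h ≠ ⊥ := by
    rintro rfl
    have h1 := hC.self_normalizing
    obtain ⟨y, hy⟩ := exists_ne (0 : A)
    have h2 : y ∈ (⊥ : LieSubalgebra ℂ A).normalizer := by
      rw [LieSubalgebra.mem_normalizer_iff]
      intro z hz
      rw [LieSubalgebra.mem_bot] at hz ⊢
      simp [hz]
    rw [h1, LieSubalgebra.mem_bot] at h2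
    exact hy h2
  have hle : h.toSubmodule ≤ leftRootSubspace h 0 := heq 0 ▸ le_adRootSubspace_zero h
  obtain ⟨x, hxh, hx0⟩ : ∃ x ∈ h, x ≠ 0 := by
    by_contra hcon
    push Not at hcon
    exact hne ((LieSubalgebra.eq_bot_iff h).2 hcon)
  have hspan : ∀ y ∈ leftRootSubspace h 0, ∃ a : ℂ, a • x = y := by
    intro y hy
    obtain ⟨a, ha⟩ := (finrank_le_one_iff.1 (hdim 0))
    obtain ⟨r, hr⟩ := ha ⟨x, hle hxh⟩
    obtain ⟨s, hs⟩ := ha ⟨y, hy⟩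
    have hr' : r • (a : A) = x := congrArg Subtype.val hr
    have hs' : s • (a : A) = y := congrArg Subtype.val hs
    have hr0 : r ≠ 0 := by
      rintro rfl
      exact hx0 (by rw [← hr', zero_smul])
    exact ⟨s / r, by rw [← hr', smul_smul, div_mul_cancel₀ _ hr0, hs']⟩
  let X : h := ⟨x, hxh⟩
  have hX : ∀ y : h, ∃ a : ℂ, y = a • X := by
    intro y
    obtain ⟨a, ha⟩ := hspan y (hle y.2)
    exact ⟨a, Subtype.ext ha.symm⟩
  have hX0 : X ≠ 0 := fun h0 => hx0 (congrArg Subtype.val h0)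
  obtain ⟨χ, hχ⟩ : ∃ χ : Module.Dual ℂ h, χ X = 1 := by
    obtain ⟨f, hf⟩ := Module.exists_dual_forall_apply_eq_one (K := ℂ) (s := {()})
      (v := fun _ : Unit => X) (LinearIndepOn.singleton hX0)
    exact ⟨f, hf () rfl⟩
  have hleft : ∀ l : ℂ, leftRootSubspace h (l • χ) =
      Module.End.maxGenEigenspace (LinearMap.mulLeft ℂ x) l := by
    intro l
    have := rootSubspace_eq_maxGenEigenspace (ρ := fun x : A => LinearMap.mulLeft ℂ x)
      (fun a y => by ext z; simp [smul_mul_assoc]) X hX (l • χ)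
    simpa [hχ, leftRootSubspace] using this
  have had : ∀ l : ℂ, adRootSubspace h (l • χ) =
      Module.End.maxGenEigenspace (LieAlgebra.ad ℂ A x) l := by
    intro l
    have := rootSubspace_eq_maxGenEigenspace (ρ := fun x : A => LieAlgebra.ad ℂ A x)
      (fun a y => by simp) X hX (l • χ)
    simpa [hχ, adRootSubspace] using this
  set f : Module.End ℂ A := LinearMap.mulLeft ℂ x with hf
  have hdim' : ∀ l, Module.finrank ℂ (f.maxGenEigenspace l) ≤ 1 := fun l => hleft l ▸ hdim _
  have hL : ∀ l, ∀ v ∈ f.maxGenEigenspace l, x * v = l • v ∧ v * x = 0 := by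
    intro l v hv
    have h1 : x * v = l • v := apply_eq_smul_of_finrank_maxGenEigenspace_le_one (hdim' l) hv
    have h2 : f.maxGenEigenspace l = Module.End.maxGenEigenspace (LieAlgebra.ad ℂ A x) l := by
      rw [← hleft, ← had, heq]
    have h3 : LieAlgebra.ad ℂ A x v = l • v :=
      apply_eq_smul_of_finrank_maxGenEigenspace_le_one (h2 ▸ hdim' l) (h2 ▸ hv)
    rw [LieAlgebra.ad_apply, Ring.lie_def, h1] at h3
    exact ⟨h1, by simpa using h3⟩
  have hfin : Set.Finite {l | f.maxGenEigenspace l ≠ ⊥} :=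
    WellFoundedGT.finite_ne_bot_of_iSupIndep f.independent_maxGenEigenspace
  have hex : ∀ l, ∃ v : A, v ∈ f.maxGenEigenspace l ∧ (f.maxGenEigenspace l ≠ ⊥ → v ≠ 0) ∧
      (l = 0 → v = x) := by
    intro l
    by_cases hl : l = 0
    · subst hl
      have h1 : x ∈ f.maxGenEigenspace 0 := by
        rw [← hleft, zero_smul]
        exact hle hxh
      exact ⟨x, h1, fun _ => hx0, fun _ => rfl⟩
    · by_cases hb : f.maxGenEigenspace l = ⊥
      · exact ⟨0, zero_mem _, fun h => absurd hb h, fun h => absurd h hl⟩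
      · obtain ⟨v, hv, hv0⟩ := (Submodule.ne_bot_iff _).1 hb
        exact ⟨v, hv, fun _ => hv0, fun h => absurd h hl⟩
  choose E hE hE0 hEx using hex
  have hEx0 : E 0 = x := hEx 0 rfl
  have hmem : ∀ l, l ∈ hfin.toFinset ↔ f.maxGenEigenspace l ≠ ⊥ := fun l => hfin.mem_toFinset
  have hne0 : ∀ l ∈ hfin.toFinset, E l ≠ 0 := fun l hl => hE0 l ((hmem l).1 hl)
  have hl : ∀ l, E 0 * E l = l • E l := fun l => by rw [hEx0]; exact (hL l _ (hE l)).1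
  refine ⟨hfin.toFinset, E, exists_structure_constants ?_ hne0 ?_ hl ?_ ?_⟩
  · rw [hmem]
    refine (Submodule.ne_bot_iff _).2 ⟨E 0, hE 0, ?_⟩
    rw [hEx0]
    exact hx0
  · intro l hl
    have h1 := hE l
    rwa [not_not.1 (mt (hmem l).2 hl), Submodule.mem_bot] at h1
  · intro l
    rw [hEx0]
    exact (hL l _ (hE l)).2
  · refine le_antisymm ?_ ?_
    · have hli : LinearIndependent ℂ (fun l : hfin.toFinset => E l) :=
        linearIndependent_of_eigen (w := fun l : hfin.toFinset => (l : ℂ)) Subtype.val_injective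
          (fun l => hne0 l l.2) (fun l => hl l)
      simpa using hli.fintype_card_le_finrank
    · have htop : Submodule.span ℂ ((hfin.toFinset.image E : Finset A) : Set A) = ⊤ := by
        rw [eq_top_iff, ← f.iSup_maxGenEigenspace_eq_top]
        refine iSup_le fun l v hv => ?_
        by_cases hb : f.maxGenEigenspace l = ⊥
        · rw [hb, Submodule.mem_bot] at hv
          exact hv ▸ zero_mem _
        · obtain ⟨a, ha⟩ := finrank_le_one_iff.1 (hdim' l)
          obtain ⟨r, hr⟩ := ha ⟨E l, hE l⟩
          obtain ⟨s, hs⟩ := ha ⟨v, hv⟩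
          have hr' : r • (a : A) = E l := congrArg Subtype.val hr
          have hs' : s • (a : A) = v := congrArg Subtype.val hs
          have hr0 : r ≠ 0 := by
            rintro rfl
            exact hE0 l hb (by rw [← hr', zero_smul])
          have : v = (s / r) • E l := by
            rw [← hr', smul_smul, div_mul_cancel₀ _ hr0, hs']
          rw [this]
          refine Submodule.smul_mem _ _ (Submodule.subset_span ?_)
          rw [Finset.coe_image]
          exact ⟨l, (hmem l).2 hb, rfl⟩
      have h1 := finrank_span_finset_le_card (R := ℂ) (hfin.toFinset.image E)
      rw [Set.finrank, htop, finrank_top] at h1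
      exact h1.trans Finset.card_image_le

end CanonicalDecompositions

section Eigenbases

variable {A : Type*} [LeftPreLieRing A] [LeftPreLieAlgebra ℂ A]
  {ι : Type*} [Fintype ι] (b : Module.Basis ι ℂ A) {o : ι} {w : ι → ℂ}
  (left : ∀ i, b o * b i = w i • b i)
include left

theorem repr_mul_of_eigenbasis (y : A) (i : ι) : b.repr (b o * y) i = w i * b.repr y i := by
  classical
  conv_lhs => rw [← b.sum_repr y, Finset.mul_sum]
  simp only [mul_smul_comm, left, map_sum, map_smul, Finsupp.coe_finsetSum, Finset.sum_apply,
    Finsupp.coe_smul, Pi.smul_apply, b.repr_self, smul_eq_mul, Finsupp.single_apply]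
  simp [mul_comm]

theorem repr_pow_of_eigenbasis (l : ℂ) (k : ℕ) (y : A) (i : ι) :
    b.repr (((LinearMap.mulLeft ℂ (b o) - l • (1 : Module.End ℂ A)) ^ k) y) i =
      (w i - l) ^ k * b.repr y i := by
  induction k generalizing y with
  | zero => simp
  | succ k ih =>
    rw [pow_succ, Module.End.mul_apply, ih]
    simp only [LinearMap.sub_apply, LinearMap.smul_apply, LinearMap.mulLeft_apply,
      Module.End.one_apply, map_sub, map_smul, Finsupp.coe_sub, Finsupp.coe_smul, Pi.sub_apply,
      Pi.smul_apply, smul_eq_mul, repr_mul_of_eigenbasis b left]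
    ring

theorem hasOneDimCanonicalDecomposition_of_eigenbasis (right : ∀ i, b i * b o = 0) (ho : w o = 0)
    (hw : Function.Injective w) : HasOneDimCanonicalDecomposition A := by
  classical
  have hright : ∀ y, y * b o = 0 := by
    intro y
    rw [← b.sum_repr y, Finset.sum_mul]
    exact Finset.sum_eq_zero fun i _ => by rw [smul_mul_assoc, right, smul_zero]
  have had : (LieAlgebra.ad ℂ A (b o) : Module.End ℂ A) = LinearMap.mulLeft ℂ (b o) := by
    ext y
    simp [LieAlgebra.ad_apply, Ring.lie_def, hright]
  have hbr : ∀ y, ⁅b o, y⁆ = b o * y := fun y => by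
    rw [Ring.lie_def, hright, sub_zero]
  let h : LieSubalgebra ℂ A :=
    { ℂ ∙ b o with
      lie_mem' := by
        intro y z hy hz
        obtain ⟨r, rfl⟩ := Submodule.mem_span_singleton.1 hy
        obtain ⟨s, rfl⟩ := Submodule.mem_span_singleton.1 hz
        simp }
  have hmem : ∀ y, y ∈ h ↔ ∃ a : ℂ, a • b o = y := fun y => Submodule.mem_span_singleton
  have hab : IsLieAbelian h := by
    refine ⟨fun y z => Subtype.ext ?_⟩
    obtain ⟨r, hr⟩ := (hmem _).1 y.2
    obtain ⟨s, hs⟩ := (hmem _).1 z.2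
    rw [LieSubalgebra.coe_bracket, ← hr, ← hs]
    simp
  let X : h := ⟨b o, (hmem _).2 ⟨1, one_smul _ _⟩⟩
  have hX : ∀ y : h, ∃ a : ℂ, y = a • X := by
    intro y
    obtain ⟨a, ha⟩ := (hmem _).1 y.2
    exact ⟨a, Subtype.ext ha.symm⟩
  have hL : ∀ χ, leftRootSubspace h χ =
      Module.End.maxGenEigenspace (LinearMap.mulLeft ℂ (b o)) (χ X) := fun χ =>
    rootSubspace_eq_maxGenEigenspace (ρ := fun x : A => LinearMap.mulLeft ℂ x)
      (fun a y => by ext z; simp [smul_mul_assoc]) X hX χ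
  have hD : ∀ χ, adRootSubspace h χ =
      Module.End.maxGenEigenspace (LieAlgebra.ad ℂ A (b o)) (χ X) := fun χ =>
    rootSubspace_eq_maxGenEigenspace (ρ := fun x : A => LieAlgebra.ad ℂ A x)
      (fun a y => by simp) X hX χ
  refine ⟨h, ⟨⟨inferInstance, le_antisymm ?_ (LieSubalgebra.le_normalizer _)⟩, ?_⟩, ?_⟩
  · intro y hy
    rw [LieSubalgebra.mem_normalizer_iff'] at hy
    obtain ⟨a, ha⟩ := (hmem _).1 (hy (b o) X.2)
    refine (hmem _).2 ⟨b.repr y o, ?_⟩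
    refine b.repr.injective (Finsupp.ext fun i => ?_)
    have h1 := congrArg (fun z => b.repr z i) ha
    simp only [hbr, repr_mul_of_eigenbasis b left, map_smul, b.repr_self, Finsupp.coe_smul,
      Pi.smul_apply, Finsupp.single_apply, smul_eq_mul] at h1 ⊢
    by_cases hi : o = i
    · simp [hi]
    · have hwi : w i ≠ 0 := fun h0 => hi (hw (ho.trans h0.symm))
      simp only [hi, if_false, mul_zero] at h1 ⊢
      exact ((mul_eq_zero.1 h1.symm).resolve_left hwi).symm
  · intro χ
    rw [hL, hD, had]
  · intro χ
    rw [hL]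
    have hz : ∀ y ∈ Module.End.maxGenEigenspace (LinearMap.mulLeft ℂ (b o)) (χ X),
        ∀ i, w i ≠ χ X → b.repr y i = 0 := by
      intro y hy i hi
      obtain ⟨k, hk⟩ := (Module.End.mem_maxGenEigenspace _ _ _).1 hy
      have h1 := repr_pow_of_eigenbasis b left (χ X) k y i
      rw [hk, map_zero, Finsupp.coe_zero, Pi.zero_apply, eq_comm] at h1
      exact (mul_eq_zero.1 h1).resolve_left (pow_ne_zero _ (sub_ne_zero.2 hi))
    have hle : ∃ z : A, Module.End.maxGenEigenspace (LinearMap.mulLeft ℂ (b o)) (χ X) ≤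
        ℂ ∙ z := by
      by_cases hi : ∃ i, w i = χ X
      · obtain ⟨i, hi⟩ := hi
        refine ⟨b i, fun y hy => Submodule.mem_span_singleton.2 ⟨b.repr y i, ?_⟩⟩
        conv_rhs => rw [← b.sum_repr y]
        rw [Finset.sum_eq_single i]
        · intro j _ hj
          rw [hz y hy j (fun h0 => hj (hw (h0.trans hi.symm))), zero_smul]
        · simp
      · push Not at hi
        refine ⟨0, fun y hy => ?_⟩
        rw [← b.sum_repr y, Finset.sum_eq_zero fun i _ => by rw [hz y hy i (hi i), zero_smul]]
        exact zero_mem _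
    obtain ⟨z, hz⟩ := hle
    have := Module.Finite.of_basis b
    exact (Submodule.finrank_mono hz).trans ((finrank_span_le_card ({z} : Set A)).trans (by simp))

theorem isSimple_of_eigenbasis (ho : w o = 0) (hw : Function.Injective w)
    (h : ∀ J : Submodule ℂ A, IsIdeal J → ∀ i, b i ∈ J → b o ∈ J) : IsSimple A := by
  classical
  refine ⟨⟨b o, 0, b.ne_zero o⟩, fun J hJ => ?_⟩
  rw [or_iff_not_imp_left]
  intro hbot
  obtain ⟨x, hx, hx0⟩ := (Submodule.ne_bot_iff _).1 hbot
  obtain ⟨i, hi⟩ : ∃ i, b.repr x i ≠ 0 := by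
    by_contra hcon
    push Not at hcon
    exact hx0 (b.repr.injective (by ext i; simp [hcon i]))
  have key : ∀ s : Finset ι, ∃ y ∈ J, b.repr y i ≠ 0 ∧ ∀ j ∈ s, j ≠ i → b.repr y j = 0 := by
    intro s
    induction s using Finset.induction_on with
    | empty => exact ⟨x, hx, hi, by simp⟩
    | insert j s _ ih =>
      obtain ⟨y, hy, hyi, hys⟩ := ih
      by_cases hji : j = i
      · refine ⟨y, hy, hyi, fun k hk hki => ?_⟩
        rcases Finset.mem_insert.1 hk with rfl | hk
        · exact absurd hji hki
        · exact hys k hk hki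
      · have hrepr : ∀ k, b.repr (b o * y - w j • y) k = (w k - w j) * b.repr y k := by
          intro k
          simp only [map_sub, map_smul, Finsupp.coe_sub, Finsupp.coe_smul, Pi.sub_apply,
            Pi.smul_apply, smul_eq_mul, repr_mul_of_eigenbasis b left]
          ring
        refine ⟨b o * y - w j • y, J.sub_mem (hJ y hy (b o)).2 (J.smul_mem _ hy), ?_, ?_⟩
        · rw [hrepr]
          exact mul_ne_zero (sub_ne_zero.2 fun h0 => hji (hw h0).symm) hyi
        · intro k hk hki
          rw [hrepr]
          rcases Finset.mem_insert.1 hk with rfl | hk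
          · rw [sub_self, zero_mul]
          · rw [hys k hk hki, mul_zero]
  obtain ⟨y, hy, hyi, hys⟩ := key Finset.univ
  have hbi : b i ∈ J := by
    have h1 : y = b.repr y i • b i := by
      conv_lhs => rw [← b.sum_repr y]
      refine Finset.sum_eq_single i (fun j hj hji => ?_) (by simp)
      rw [hys j hj hji, zero_smul]
    rw [h1] at hy
    exact (J.smul_mem_iff hyi).1 hy
  have hbo := h J hJ i hbi
  rw [eq_top_iff, ← b.span_eq, Submodule.span_le]
  rintro _ ⟨j, rfl⟩
  by_cases hj : j = o
  · rwa [hj]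
  · have h1 := (hJ (b o) hbo (b j)).1
    rw [left] at h1
    exact (J.smul_mem_iff fun h0 => hj (hw (h0.trans ho.symm))).1 h1

end Eigenbases

section Completeness

variable {A : Type*} [LeftPreLieRing A] [LeftPreLieAlgebra ℂ A]

/-- If left multiplication by `x` is nilpotent of small order, then the time-one flow of `F_x` is
given by a polynomial formula. -/
theorem exists_mem_affineGroup_of_nilpotent {x : A}
    (hx : ∀ y, x * (x * (x * (x * y + x))) = 0) : ∃ g ∈ affineGroup A, ∀ y, g y =
      y + (x * y + x) + (1 / 2 : ℂ) • (x * (x * y + x)) +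
        (1 / 6 : ℂ) • (x * (x * (x * y + x))) := by
  let F : ℂ → A → A := fun s y =>
      y + s • (x * y + x) + (s ^ 2 / 2) • (x * (x * y + x)) +
        (s ^ 3 / 6) • (x * (x * (x * y + x)))
  have hF : ∀ s y, F s y = y + s • (x * y + x) + (s ^ 2 / 2) • (x * (x * y + x)) +
        (s ^ 3 / 6) • (x * (x * (x * y + x))) := fun _ _ => rfl
  have hxF : ∀ s y, x * F s y + x = (x * y + x) + s • (x * (x * y + x)) +
      (s ^ 2 / 2) • (x * (x * (x * y + x))) := by
    intro s y
    rw [hF, mul_add, mul_add, mul_add, mul_smul_comm, mul_smul_comm, mul_smul_comm, hx]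
    module
  have hinv : ∀ s y, F (-s) (F s y) = y := by
    intro s y
    rw [hF (-s) (F s y), hxF]
    have h1 : x * (x * y + x + s • (x * (x * y + x)) +
        (s ^ 2 / 2) • (x * (x * (x * y + x)))) =
        x * (x * y + x) + s • (x * (x * (x * y + x))) := by
      rw [mul_add, mul_add, mul_smul_comm, mul_smul_comm, hx, smul_zero, add_zero]
    have h2 : x * (x * (x * y + x) + s • (x * (x * (x * y + x)))) = x * (x * (x * y + x)) := by
      rw [mul_add, mul_smul_comm, hx, smul_zero, add_zero]
    rw [h1, h2, hF]
    module
  let g : Equiv.Perm A := ⟨F 1, F (-1), hinv 1, fun y => by simpa using hinv (-1) y⟩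
  refine ⟨g, Subgroup.subset_closure ⟨x, fun y => ⟨fun s => F s y, ?_, ?_, ?_⟩⟩, fun y => ?_⟩
  · simp [hF]
  · simp [g]
  · intro t φ
    simp only [hxF]
    simp only [hF, map_add, map_smul, smul_eq_mul]
    set a := x * y + x
    have ht : HasDerivAt (fun s : ℝ => (s : ℂ)) 1 t := Complex.ofRealCLM.hasDerivAt
    have h1 := ((((hasDerivAt_const t (φ y)).add (ht.mul_const (φ a))).add
      (((ht.pow 2).div_const 2).mul_const (φ (x * a)))).add
      (((ht.pow 3).div_const 6).mul_const (φ (x * (x * a)))))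
    rw [← map_add]
    refine h1.congr_deriv ?_
    push_cast
    ring
  · change F 1 y = _
    rw [hF]
    norm_num

theorem exists_mem_affineGroup_translate {ι : Type*} [Fintype ι] (b : Module.Basis ι ℂ A) {o : ι}
    {w : ι → ℂ} (left : ∀ i, b o * b i = w i • b i) (ho : w o = 0) (r s : ℂ) :
    ∃ g ∈ affineGroup A, g (r • b o) = s • b o := by
  classical
  let F : ℂ → A → A := fun t y =>
    ∑ i, (Complex.exp (t * (s - r) * w i) * b.repr y i) • b i + (t * (s - r)) • b o
  have hF : ∀ t y, F t y = ∑ i, (Complex.exp (t * (s - r) * w i) * b.repr y i) • b i +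
    (t * (s - r)) • b o := fun _ _ => rfl
  have hrepr : ∀ t y i, b.repr (F t y) i = Complex.exp (t * (s - r) * w i) * b.repr y i +
      if o = i then t * (s - r) else 0 := by
    intro t y i
    rw [hF, map_add, Finsupp.add_apply, b.repr_sum_self, map_smul, b.repr_self, Finsupp.smul_apply,
      Finsupp.single_apply, smul_eq_mul, mul_ite, mul_one, mul_zero]
  have hinv : ∀ t y, F (-t) (F t y) = y := by
    intro t y
    refine b.repr.injective (Finsupp.ext fun i => ?_)
    rw [hrepr, hrepr]
    by_cases hi : o = i
    · subst hi
      simp [ho]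
    · simp only [hi, if_false, add_zero]
      rw [← mul_assoc, ← Complex.exp_add]
      simp
  let g : Equiv.Perm A := ⟨F 1, F (-1), hinv 1, fun y => by simpa using hinv (-1) y⟩
  refine ⟨g, Subgroup.subset_closure ⟨(s - r) • b o, fun y => ⟨fun t => F t y, ?_, ?_, ?_⟩⟩, ?_⟩
  · simp [hF, b.sum_repr]
  · simp [g]
  · intro t φ
    have hmul : (s - r) • b o * F t y + (s - r) • b o =
        ∑ i, (Complex.exp (t * (s - r) * w i) * ((s - r) * w i) * b.repr y i) • b i +
          (s - r) • b o := by
      rw [hF, mul_add, Finset.mul_sum, smul_mul_smul_comm, left, ho, zero_smul, smul_zero, add_zero]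
      congr 1
      refine Finset.sum_congr rfl fun i _ => ?_
      rw [smul_mul_smul_comm, left, smul_smul]
      congr 1
      ring
    simp only [hmul]
    simp only [hF, map_add, map_sum, map_smul, smul_eq_mul]
    have ht : HasDerivAt (fun s : ℝ => (s : ℂ)) 1 t := Complex.ofRealCLM.hasDerivAt
    refine HasDerivAt.add (HasDerivAt.fun_sum fun i _ => ?_) ?_
    · have h1 := ((((ht.mul_const (s - r)).mul_const (w i)).cexp.mul_const
        (b.repr y i)).mul_const (φ (b i)))
      simpa using h1
    · simpa using (ht.mul_const (s - r)).mul_const (φ (b o))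
  · refine b.repr.injective (Finsupp.ext fun i => ?_)
    change b.repr (F 1 (r • b o)) i = _
    rw [hrepr]
    by_cases hi : o = i
    · subst hi
      simp [ho]
    · simp [hi]

theorem isComplete_of_eigenbasis {ι : Type*} [Fintype ι] (b : Module.Basis ι ℂ A) {o : ι}
    {w : ι → ℂ} (left : ∀ i, b o * b i = w i • b i) (ho : w o = 0)
    (h : ∀ y, ∃ g ∈ affineGroup A, ∃ r : ℂ, g y = r • b o) : IsComplete A := by
  intro y z
  obtain ⟨g, hg, r, hr⟩ := h y
  obtain ⟨k, hk, s, hs⟩ := h z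
  obtain ⟨t, ht, hts⟩ := exists_mem_affineGroup_translate b left ho r s
  refine ⟨k⁻¹ * t * g, mul_mem (mul_mem (inv_mem hk) ht) hg, ?_⟩
  rw [Equiv.Perm.mul_apply, Equiv.Perm.mul_apply, hr, hts, ← hs]
  exact k.symm_apply_apply z

end Completeness

namespace Grading

variable {A : Type*} [LeftPreLieRing A] [LeftPreLieAlgebra ℂ A]
  {Λ : Finset ℂ} {E : ℂ → A} {c : ℂ → ℂ → ℂ} (G : Grading A Λ E c)
include G

theorem mul_eq_zero_of_add {l m : ℂ} (h : l + m ∉ Λ) : E l * E m = 0 := by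
  rw [G.mul, G.const_eq_zero_of_add h, zero_smul]

/-- A weight vector that multiplies an unpaired weight vector into a paired one is paired. -/
theorem const_neg_ne_zero_of_add {m t : ℂ} (hm : c m (-m) = 0) (h : c m t ≠ 0 ∨ c t m ≠ 0)
    (hmt : c (m + t) (-(m + t)) ≠ 0) : c t (-t) ≠ 0 := by
  intro ht
  rcases h with h | h
  · exact mul_ne_zero h hmt (G.const_mul_const_neg_add hm ht)
  · rw [add_comm] at hmt
    exact mul_ne_zero h hmt (G.const_mul_const_neg_add ht hm)

theorem mem_add_of_or {m t : ℂ} (h : c m t ≠ 0 ∨ c t m ≠ 0) : m + t ∈ Λ := by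
  rcases h with h | h
  · exact G.mem_add _ _ h
  · rw [add_comm]
    exact G.mem_add _ _ h

theorem mem_of_or {m t : ℂ} (h : c m t ≠ 0 ∨ c t m ≠ 0) : t ∈ Λ := by
  rcases h with h | h
  · exact G.mem_right _ _ h
  · exact G.mem_left _ _ h

end Grading

/-- In a simple algebra the grading can be normalized so that the weights `1` and `-1` are
paired. -/
theorem exists_normalized_grading {A : Type*} [LeftPreLieRing A] [LeftPreLieAlgebra ℂ A]
    [FiniteDimensional ℂ A] (hs : IsSimple A) (hA : HasOneDimCanonicalDecomposition A)
    (hd : 2 ≤ Module.finrank ℂ A) : ∃ Λ E c, Grading A Λ E c ∧ c 1 (-1) ≠ 0 := by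
  have := hs.1
  obtain ⟨Λ, E, c, G⟩ := exists_grading hA
  obtain ⟨s, hs, t, hst, h⟩ := G.exists_exit hs (Λ.erase_subset 0)
    (by rw [← Finset.card_pos, Finset.card_erase_of_mem G.zero_mem, G.card]; omega)
    (Finset.notMem_erase 0 Λ)
  have hs0 : s ≠ 0 := Finset.ne_of_mem_erase hs
  have ht : t = -s := by
    have h1 := G.mem_add_of_or h
    rw [Finset.mem_erase, not_and_or, not_not] at hst
    exact eq_neg_of_add_eq_zero_right (hst.resolve_right (not_not.2 h1))
  subst ht
  rw [G.const_neg_comm, or_self] at h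
  refine ⟨_, _, _, G.rescale (inv_ne_zero hs0), ?_⟩
  rw [div_inv_eq_mul, div_inv_eq_mul, one_mul, neg_one_mul, G.const_neg_comm]
  exact mul_ne_zero (inv_ne_zero hs0) h

theorem Grading.three_subset {A : Type*} [LeftPreLieRing A] [LeftPreLieAlgebra ℂ A]
    {Λ : Finset ℂ} {E : ℂ → A} {c : ℂ → ℂ → ℂ} (G : Grading A Λ E c) (hp : c 1 (-1) ≠ 0) :
    ({0, 1, -1} : Finset ℂ) ⊆ Λ := by
  intro l hl
  simp only [Finset.mem_insert, Finset.mem_singleton] at hl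
  rcases hl with rfl | rfl | rfl
  · exact G.zero_mem
  · exact G.mem_left _ _ hp
  · exact G.mem_right _ _ hp

theorem card_three : ({0, 1, -1} : Finset ℂ).card = 3 := by
  rw [Finset.card_eq_three]
  exact ⟨0, 1, -1, by norm_num, by norm_num, by norm_num, rfl⟩

theorem finrank_ne_two {A : Type*} [LeftPreLieRing A] [LeftPreLieAlgebra ℂ A]
    [FiniteDimensional ℂ A] (hs : IsSimple A) (hA : HasOneDimCanonicalDecomposition A) :
    Module.finrank ℂ A ≠ 2 := by
  intro hd
  obtain ⟨Λ, E, c, G, hp⟩ := exists_normalized_grading hs hA hd.ge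
  have h := Finset.card_le_card (G.three_subset hp)
  rw [card_three, G.card, hd] at h
  omega

theorem iso_auslander {A : Type*} [LeftPreLieRing A] [LeftPreLieAlgebra ℂ A]
    [FiniteDimensional ℂ A] (hs : IsSimple A) (hA : HasOneDimCanonicalDecomposition A)
    (hd : Module.finrank ℂ A = 3) : Iso A auslander.Alg := by
  obtain ⟨Λ, E, c, G, hp⟩ := exists_normalized_grading hs hA (by omega)
  have hΛ := Finset.eq_of_subset_of_card_le (G.three_subset hp) (by rw [card_three, G.card, hd])
  have h00 : E 0 * E 0 = 0 := G.right 0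
  have h01 : E 0 * E 1 = E 1 := by rw [G.left, one_smul]
  have h02 : E 0 * E (-1) = -E (-1) := by rw [G.left, neg_one_smul]
  have h10 := G.right 1
  have h20 := G.right (-1)
  have h11 : E 1 * E 1 = 0 := G.mul_eq_zero_of_add (by rw [← hΛ]; norm_num)
  have h22 : E (-1) * E (-1) = 0 := G.mul_eq_zero_of_add (by rw [← hΛ]; norm_num)
  have h12 : E 1 * E (-1) = c 1 (-1) • E 0 := by rw [G.mul, add_neg_cancel]
  have h21 : E (-1) * E 1 = c 1 (-1) • E 0 := by rw [G.mul, neg_add_cancel, G.const_neg_comm]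
  have hm : ∀ l ∈ ({0, 1, -1} : Finset ℂ), E l ≠ 0 := fun l hl => G.ne_zero l (hΛ ▸ hl)
  refine iso_of_eigenbasis auslander (x := E 0) (w := ![0, 1, -1])
    (v := ![E 0, E 1, (c 1 (-1))⁻¹ • E (-1)]) hd ?_ ?_ ?_ ?_
  · intro i j
    fin_cases i <;> fin_cases j <;> norm_num
  · intro i
    fin_cases i
    · exact hm 0 (by simp)
    · exact hm 1 (by simp)
    · exact smul_ne_zero (inv_ne_zero hp) (hm (-1) (by simp))
  · intro i
    fin_cases i <;> simp [h00, h01, h02, mul_smul_comm]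
  · intro i j
    fin_cases i <;> fin_cases j <;>
      simp [auslander, e, h00, h01, h02, h10, h11, h12, h20, h21, h22, hp,
        mul_smul_comm, smul_mul_assoc]

theorem iso_dimFour_of_grading {A : Type*} [LeftPreLieRing A] [LeftPreLieAlgebra ℂ A]
    [FiniteDimensional ℂ A] (hd : Module.finrank ℂ A = 4)
    {Λ : Finset ℂ} {E : ℂ → A} {c : ℂ → ℂ → ℂ} (G : Grading A Λ E c) (hp : c 1 (-1) ≠ 0)
    (hΛ : ∀ l, l ∈ Λ ↔ l = 0 ∨ l = 1 ∨ l = -1 ∨ l = 2)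
    (h2 : c 2 (-1) ≠ 0 ∨ c (-1) 2 ≠ 0) : Iso A dimFour.Alg := by
  have hneg := G.const_neg_comm 1
  have hab : c (-1) 2 = 2 * c 2 (-1) := by
    have h := G.left_symm 2 (-1) (-1)
    norm_num at h
    rw [G.const_eq_zero_of_add (l := -1) (m := -1) (by rw [hΛ]; norm_num), ← hneg] at h
    refine mul_right_cancel₀ hp ?_
    linear_combination -h
  have hb : c 2 (-1) ≠ 0 := by
    intro h0
    rw [hab, h0] at h2
    simp at h2
  have hc11 : c 1 1 = 0 := by
    have h := G.const_mul_const_neg (l := 1) one_ne_zero 1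
    norm_num at h
    refine h.resolve_right ?_
    rw [hab]
    exact mul_ne_zero two_ne_zero hb
  have h00 : E 0 * E 0 = 0 := G.right 0
  have h01 : E 0 * E (-1) = -E (-1) := by rw [G.left, neg_one_smul]
  have h02 : E 0 * E 1 = E 1 := by rw [G.left, one_smul]
  have h03 : E 0 * E 2 = (2 : ℂ) • E 2 := G.left 2
  have h10 := G.right (-1)
  have h20 := G.right 1
  have h30 := G.right 2
  have h11 : E (-1) * E (-1) = 0 := G.mul_eq_zero_of_add (by rw [hΛ]; norm_num)
  have h12 : E (-1) * E 1 = c 1 (-1) • E 0 := by rw [G.mul, neg_add_cancel, G.const_neg_comm]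
  have h13 : E (-1) * E 2 = (2 * c 2 (-1)) • E 1 := by
    rw [G.mul, hab]; norm_num
  have h21 : E 1 * E (-1) = c 1 (-1) • E 0 := by rw [G.mul, add_neg_cancel]
  have h22 : E 1 * E 1 = 0 := by rw [G.mul, hc11, zero_smul]
  have h23 : E 1 * E 2 = 0 := G.mul_eq_zero_of_add (by rw [hΛ]; norm_num)
  have h31 : E 2 * E (-1) = c 2 (-1) • E 1 := by rw [G.mul]; norm_num
  have h32 : E 2 * E 1 = 0 := G.mul_eq_zero_of_add (by rw [hΛ]; norm_num)
  have h33 : E 2 * E 2 = 0 := G.mul_eq_zero_of_add (by rw [hΛ]; norm_num)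
  refine iso_of_eigenbasis dimFour (x := E 0) (w := ![0, -1, 1, 2])
    (v := ![E 0, (c 1 (-1))⁻¹ • E (-1), E 1, (c 1 (-1) * (c 2 (-1))⁻¹) • E 2]) hd ?_ ?_ ?_ ?_
  · intro i j
    fin_cases i <;> fin_cases j <;> norm_num
  · intro i
    fin_cases i
    · exact G.ne_zero 0 (by simp [hΛ])
    · exact smul_ne_zero (inv_ne_zero hp) (G.ne_zero (-1) (by simp [hΛ]))
    · exact G.ne_zero 1 (by simp [hΛ])
    · exact smul_ne_zero (mul_ne_zero hp (inv_ne_zero hb)) (G.ne_zero 2 (by simp [hΛ]))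
  · intro i
    fin_cases i <;> simp [h00, h01, h02, h03, mul_smul_comm, smul_smul, mul_comm]
  · intro i j
    fin_cases i <;> fin_cases j <;>
      simp [Fin.sum_univ_four, dimFour, e, h00, h01, h02, h03, h10, h11, h12, h13, h20, h21, h22,
        h23, h30, h31, h32, h33, hp, mul_smul_comm, smul_mul_assoc, smul_smul] <;> field_simp <;> simp

theorem Grading.eq_two_or_neg_two {A : Type*} [LeftPreLieRing A] [LeftPreLieAlgebra ℂ A]
    {Λ : Finset ℂ} {E : ℂ → A} {c : ℂ → ℂ → ℂ} (G : Grading A Λ E c) (hp : c 1 (-1) ≠ 0)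
    {m t : ℂ} (hm : c m (-m) = 0) (hm0 : m ≠ 0) (h : c m t ≠ 0 ∨ c t m ≠ 0)
    (hmt : m + t = 0 ∨ m + t = 1 ∨ m + t = -1)
    (ht : c t (-t) ≠ 0 → t = 1 ∨ t = -1) : (m = 2 ∧ t = -1) ∨ (m = -2 ∧ t = 1) := by
  have hq : c (-1) 1 ≠ 0 := by rwa [← G.const_neg_comm]
  rcases hmt with h0 | h0 | h0
  · obtain rfl : t = -m := by linear_combination h0
    rw [← G.const_neg_comm, or_self] at h
    exact absurd hm h
  · rcases ht (G.const_neg_ne_zero_of_add hm h (by rwa [h0])) with rfl | rfl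
    · exact absurd (by linear_combination h0) hm0
    · exact Or.inl ⟨by linear_combination h0, rfl⟩
  · rcases ht (G.const_neg_ne_zero_of_add hm h (by rwa [h0, neg_neg])) with rfl | rfl
    · exact Or.inr ⟨by linear_combination h0, rfl⟩
    · exact absurd (by linear_combination h0) hm0

theorem iso_dimFour {A : Type*} [LeftPreLieRing A] [LeftPreLieAlgebra ℂ A]
    [FiniteDimensional ℂ A] (hs : IsSimple A) (hA : HasOneDimCanonicalDecomposition A)
    (hd : Module.finrank ℂ A = 4) : Iso A dimFour.Alg := by
  obtain ⟨Λ, E, c, G, hp⟩ := exists_normalized_grading hs hA (by omega)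
  have hsub := G.three_subset hp
  obtain ⟨m, hm⟩ := Finset.card_eq_one.1
    (show (Λ \ {0, 1, -1}).card = 1 by rw [Finset.card_sdiff_of_subset hsub, card_three, G.card, hd])
  have hΛ : ∀ l, l ∈ Λ ↔ l = 0 ∨ l = 1 ∨ l = -1 ∨ l = m := by
    intro l
    rw [← Finset.sdiff_union_of_subset hsub, hm]
    simp only [Finset.mem_union, Finset.mem_singleton, Finset.mem_insert]
    tauto
  have hm' : m ∈ Λ \ {0, 1, -1} := by simp [hm]
  simp only [Finset.mem_sdiff, Finset.mem_insert, Finset.mem_singleton, not_or] at hm'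
  obtain ⟨hmΛ, hm0, hm1, hm2⟩ := hm'
  have hiso : c m (-m) = 0 := by
    refine G.const_eq_zero_of_right ?_ _
    rw [hΛ]
    grind
  obtain ⟨s, hs, t, hst, h⟩ := G.exists_exit hs (S := {m}) (by simpa using hmΛ) (by simp)
    (by simpa using Ne.symm hm0)
  obtain rfl := Finset.mem_singleton.1 hs
  have hmt := (hΛ _).1 (G.mem_add_of_or h)
  have htΛ := (hΛ _).1 (G.mem_of_or h)
  rw [Finset.mem_singleton] at hst
  rcases G.eq_two_or_neg_two hp hiso hm0 h (by tauto) (by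
    intro ht
    rcases htΛ with rfl | rfl | rfl | rfl
    · exact absurd (add_zero _) hst
    · simp
    · simp
    · exact absurd hiso ht) with ⟨rfl, rfl⟩ | ⟨rfl, rfl⟩
  · exact iso_dimFour_of_grading hd G hp hΛ h
  · have hneg : (-1 : ℂ) ≠ 0 := by norm_num
    refine iso_dimFour_of_grading hd (G.rescale hneg) ?_ ?_ ?_
    · have h1 := G.const_neg_comm 1
      simpa [div_neg, ← h1] using hp
    · intro l
      rw [mem_image_const_mul Λ hneg, hΛ]
      grind
    · simpa [div_neg] using h

section DimensionFive

variable {A : Type*} [LeftPreLieRing A] [LeftPreLieAlgebra ℂ A]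

theorem iso_of_prod_eq_pairsProd (hd : Module.finrank ℂ A = 5) {Λ : Finset ℂ} {E : ℂ → A}
    {c : ℂ → ℂ → ℂ} (G : Grading A Λ E c) {l α β γ : ℂ} (hl0 : l ≠ 0) (hl1 : l ≠ 1)
    (hl2 : l ≠ -1) (hp : c 1 (-1) ≠ 0) (hr : c l (-l) ≠ 0)
    (h11 : E 1 * E 1 = 0) (h13 : E 1 * E l = 0) (h14 : E 1 * E (-l) = 0)
    (h22 : E (-1) * E (-1) = (γ * c 1 (-1) ^ 2 * (c l (-l))⁻¹) • E (-l))
    (h23 : E (-1) * E l = (β * c 1 (-1)) • E 1)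
    (h24 : E (-1) * E (-l) = 0)
    (h31 : E l * E 1 = 0) (h32 : E l * E (-1) = (α * c 1 (-1)) • E 1) (h33 : E l * E l = 0)
    (h41 : E (-l) * E 1 = 0) (h42 : E (-l) * E (-1) = 0) (h44 : E (-l) * E (-l) = 0)
    (T : Table 5) (hT : T.prod = pairsProd l α β γ) : Iso A T.Alg := by
  have h00 : E 0 * E 0 = 0 := G.right 0
  have h01 : E 0 * E 1 = E 1 := by rw [G.left, one_smul]
  have h02 : E 0 * E (-1) = -E (-1) := by rw [G.left, neg_one_smul]
  have h03 : E 0 * E l = l • E l := G.left l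
  have h04 : E 0 * E (-l) = -(l • E (-l)) := by rw [G.left, neg_smul]
  have h10 := G.right 1
  have h20 := G.right (-1)
  have h30 := G.right l
  have h40 := G.right (-l)
  have h12 : E 1 * E (-1) = c 1 (-1) • E 0 := by rw [G.mul, add_neg_cancel]
  have h21 : E (-1) * E 1 = c 1 (-1) • E 0 := by rw [G.mul, neg_add_cancel, G.const_neg_comm]
  have h34 : E l * E (-l) = c l (-l) • E 0 := by rw [G.mul, add_neg_cancel]
  have h43 : E (-l) * E l = c l (-l) • E 0 := by rw [G.mul, neg_add_cancel, G.const_neg_comm]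
  refine iso_of_eigenbasis T (x := E 0) (w := ![0, 1, -1, l, -l])
    (v := ![E 0, E 1, (c 1 (-1))⁻¹ • E (-1), E l, (c l (-l))⁻¹ • E (-l)]) hd ?_ ?_ ?_ ?_
  · intro i j h
    have h1 : -l ≠ 1 := fun h => hl2 (by linear_combination -h)
    have h2 : -l ≠ -1 := fun h => hl1 (by linear_combination -h)
    have h3 : l ≠ -l := fun h => hl0 (by linear_combination (1 / 2 : ℂ) * h)
    have h4 : (1 : ℂ) ≠ -1 := by norm_num
    fin_cases i <;> fin_cases j <;>
      simp [hl0, hl1, hl2, hl0.symm, hl1.symm, hl2.symm, h1, h2, h3, h4, h1.symm, h2.symm, h3.symm,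
        h4.symm] at h ⊢
  · intro i
    fin_cases i
    · exact G.ne_zero 0 G.zero_mem
    · exact G.ne_zero 1 (G.mem_left _ _ hp)
    · exact smul_ne_zero (inv_ne_zero hp) (G.ne_zero (-1) (G.mem_right _ _ hp))
    · exact G.ne_zero l (G.mem_left _ _ hr)
    · exact smul_ne_zero (inv_ne_zero hr) (G.ne_zero (-l) (G.mem_right _ _ hr))
  · intro i
    fin_cases i <;> simp [h00, h01, h02, h03, h04, mul_smul_comm, smul_smul, mul_comm]
  · intro i j
    rw [hT]
    fin_cases i <;> fin_cases j <;>
      simp [Fin.sum_univ_five, pairsProd, e, h00, h01, h02, h03, h04, h10, h11, h12, h13, h14, h20, h21, h22, h23, h24,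
        h30, h31, h32, h33, h34, h40, h41, h42, h43, h44, hp, hr, mul_smul_comm, smul_mul_assoc,
        smul_smul] <;> field_simp

theorem iso_chain_of_grading (hd : Module.finrank ℂ A = 5)
    {Λ : Finset ℂ} {E : ℂ → A} {c : ℂ → ℂ → ℂ} (G : Grading A Λ E c) (hp : c 1 (-1) ≠ 0)
    (hΛ : ∀ l, l ∈ Λ ↔ l = 0 ∨ l = 1 ∨ l = -1 ∨ l = 2 ∨ l = 3)
    (h2 : c 2 (-1) ≠ 0 ∨ c (-1) 2 ≠ 0) (h3 : c 3 (-1) ≠ 0 ∨ c (-1) 3 ≠ 0) :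
    Iso A chain.Alg := by
  have hneg := G.const_neg_comm 1
  have hz : c (-1) (-1) = 0 := G.const_eq_zero_of_add (by rw [hΛ]; norm_num)
  have hab : c (-1) 2 = 2 * c 2 (-1) := by
    have h := G.left_symm 2 (-1) (-1)
    norm_num at h
    rw [hz, ← hneg] at h
    refine mul_right_cancel₀ hp ?_
    linear_combination -h
  have hb : c 2 (-1) ≠ 0 := by
    intro h0
    rw [hab, h0] at h2
    simp at h2
  have hab3 : c (-1) 3 = 3 * c 3 (-1) := by
    have h := G.left_symm 3 (-1) (-1)
    norm_num at h
    rw [hz, hab] at h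
    refine mul_right_cancel₀ hb ?_
    linear_combination -h
  have hb3 : c 3 (-1) ≠ 0 := by
    intro h0
    rw [hab3, h0] at h3
    simp at h3
  have hc11 : c 1 1 = 0 := by
    have h := G.const_mul_const_neg (l := 1) one_ne_zero 1
    norm_num at h
    exact h.resolve_right (by rw [hab]; exact mul_ne_zero two_ne_zero hb)
  have hc12 : c 1 2 = 0 := by
    have h := G.const_mul_const_neg (l := 1) one_ne_zero 2
    norm_num at h
    exact h.resolve_right (by rw [hab3]; exact mul_ne_zero three_ne_zero hb3)
  have hc21 : c 2 1 = 0 := by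
    have h := G.left_symm 3 (-1) 1
    norm_num at h
    rw [G.const_zero_right, G.const_eq_zero_of_add (l := 3) (m := 1) (by rw [hΛ]; norm_num),
      hab3] at h
    have h4 : c 3 (-1) * c 2 1 = 0 := by linear_combination (-1 / 2 : ℂ) * h
    exact (mul_eq_zero.1 h4).resolve_left hb3
  have h00 : E 0 * E 0 = 0 := G.right 0
  have h01 : E 0 * E (-1) = -E (-1) := by rw [G.left, neg_one_smul]
  have h02 : E 0 * E 1 = E 1 := by rw [G.left, one_smul]
  have h03 : E 0 * E 2 = (2 : ℂ) • E 2 := G.left 2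
  have h04 : E 0 * E 3 = (3 : ℂ) • E 3 := G.left 3
  have h10 := G.right (-1)
  have h20 := G.right 1
  have h30 := G.right 2
  have h40 := G.right 3
  have h11 : E (-1) * E (-1) = 0 := by rw [G.mul, hz, zero_smul]
  have h12 : E (-1) * E 1 = c 1 (-1) • E 0 := by rw [G.mul, neg_add_cancel, G.const_neg_comm]
  have h13 : E (-1) * E 2 = (2 * c 2 (-1)) • E 1 := by
    rw [G.mul, hab]; norm_num
  have h14 : E (-1) * E 3 = (3 * c 3 (-1)) • E 2 := by
    rw [G.mul, hab3]; norm_num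
  have h21 : E 1 * E (-1) = c 1 (-1) • E 0 := by rw [G.mul, add_neg_cancel]
  have h22 : E 1 * E 1 = 0 := by rw [G.mul, hc11, zero_smul]
  have h23 : E 1 * E 2 = 0 := by rw [G.mul, hc12, zero_smul]
  have h24 : E 1 * E 3 = 0 := G.mul_eq_zero_of_add (by rw [hΛ]; norm_num)
  have h31 : E 2 * E (-1) = c 2 (-1) • E 1 := by rw [G.mul]; norm_num
  have h32 : E 2 * E 1 = 0 := by rw [G.mul, hc21, zero_smul]
  have h33 : E 2 * E 2 = 0 := G.mul_eq_zero_of_add (by rw [hΛ]; norm_num)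
  have h34 : E 2 * E 3 = 0 := G.mul_eq_zero_of_add (by rw [hΛ]; norm_num)
  have h41 : E 3 * E (-1) = c 3 (-1) • E 2 := by rw [G.mul]; norm_num
  have h42 : E 3 * E 1 = 0 := G.mul_eq_zero_of_add (by rw [hΛ]; norm_num)
  have h43 : E 3 * E 2 = 0 := G.mul_eq_zero_of_add (by rw [hΛ]; norm_num)
  have h44 : E 3 * E 3 = 0 := G.mul_eq_zero_of_add (by rw [hΛ]; norm_num)
  refine iso_of_eigenbasis chain (x := E 0) (w := ![0, -1, 1, 2, 3])
    (v := ![E 0, (c 1 (-1))⁻¹ • E (-1), E 1, (c 1 (-1) * (c 2 (-1))⁻¹) • E 2,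
      (c 1 (-1) ^ 2 * (c 2 (-1))⁻¹ * (c 3 (-1))⁻¹) • E 3]) hd ?_ ?_ ?_ ?_
  · intro i j
    fin_cases i <;> fin_cases j <;> norm_num
  · intro i
    fin_cases i
    · exact G.ne_zero 0 (by simp [hΛ])
    · exact smul_ne_zero (inv_ne_zero hp) (G.ne_zero (-1) (by simp [hΛ]))
    · exact G.ne_zero 1 (by simp [hΛ])
    · exact smul_ne_zero (mul_ne_zero hp (inv_ne_zero hb)) (G.ne_zero 2 (by simp [hΛ]))
    · exact smul_ne_zero (mul_ne_zero (mul_ne_zero (pow_ne_zero 2 hp) (inv_ne_zero hb))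
        (inv_ne_zero hb3)) (G.ne_zero 3 (by simp [hΛ]))
  · intro i
    fin_cases i <;> simp [h00, h01, h02, h03, h04, mul_smul_comm, smul_smul, mul_comm]
  · intro i j
    fin_cases i <;> fin_cases j <;>
      simp [Fin.sum_univ_five, chain, chainProd, e, h00, h01, h02, h03, h04, h10, h11, h12, h13, h14, h20, h21, h22,
        h23, h24, h30, h31, h32, h33, h34, h40, h41, h42, h43, h44, hp, mul_smul_comm,
        smul_mul_assoc, smul_smul] <;> field_simp <;> simp

/-- `A` is isomorphic to an algebra in the list for dimension 5. -/
def IsListedFive (A : Type*) [LeftPreLieRing A] [LeftPreLieAlgebra ℂ A] : Prop :=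
  (∃ l : ℂ, 1 ≤ ‖l‖ ∧ l ≠ 1 ∧ l ≠ -1 ∧ Iso A (pairs l).Alg) ∨
  (∃ (α β γ : ℂ) (h : 2 * α = β + γ), (α, β, γ) ≠ 0 ∧ Iso A (pairsTwo α β γ h).Alg) ∨
  Iso A chain.Alg

theorem isListedFive_of_two (hd : Module.finrank ℂ A = 5)
    {Λ : Finset ℂ} {E : ℂ → A} {c : ℂ → ℂ → ℂ} (G : Grading A Λ E c) (hp : c 1 (-1) ≠ 0)
    (hr : c 2 (-2) ≠ 0) (hΛ : ∀ l, l ∈ Λ ↔ l = 0 ∨ l = 1 ∨ l = -1 ∨ l = 2 ∨ l = -2)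
    (h1 : c 1 1 = 0) (h2 : c (-2) 1 = 0) (h3 : c 1 (-2) = 0) : IsListedFive A := by
  set α := c 2 (-1) / c 1 (-1) with hα
  set β := c (-1) 2 / c 1 (-1) with hβ
  set γ := c (-1) (-1) * c 2 (-2) / c 1 (-1) ^ 2 with hγ
  have hrel : 2 * α = β + γ := by
    have h := G.left_symm 2 (-1) (-1)
    norm_num at h
    rw [← G.const_neg_comm 1] at h
    rw [hα, hβ, hγ]
    field_simp
    linear_combination h
  have hz : ∀ l m : ℂ, (l + m ≠ 0 ∧ l + m ≠ 1 ∧ l + m ≠ -1 ∧ l + m ≠ 2 ∧ l + m ≠ -2) →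
      E l * E m = 0 := by
    intro l m h
    refine G.mul_eq_zero_of_add ?_
    rw [hΛ]
    tauto
  have iso : ∀ T : Table 5, T.prod = pairsProd 2 α β γ → Iso A T.Alg := by
    refine iso_of_prod_eq_pairsProd hd G two_ne_zero (by norm_num) (by norm_num) hp hr ?_ ?_ ?_ ?_
      ?_ ?_ ?_ ?_ ?_ ?_ ?_ ?_
    · rw [G.mul, h1, zero_smul]
    · exact hz _ _ (by norm_num)
    · rw [G.mul, h3, zero_smul]
    · rw [G.mul, hγ]
      norm_num
      field_simp
    · rw [G.mul, hβ]
      norm_num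
      field_simp
    · exact hz _ _ (by norm_num)
    · exact hz _ _ (by norm_num)
    · rw [G.mul, hα]
      norm_num
      field_simp
    · exact hz _ _ (by norm_num)
    · rw [G.mul, h2, zero_smul]
    · exact hz _ _ (by norm_num)
    · exact hz _ _ (by norm_num)
  by_cases h0 : (α, β, γ) = 0
  · simp only [Prod.mk_eq_zero] at h0
    refine Or.inl ⟨2, by norm_num, by norm_num, by norm_num, iso (pairs 2) ?_⟩
    rw [h0.1, h0.2.1, h0.2.2, pairs]
  · exact Or.inr (Or.inl ⟨α, β, γ, hrel, h0, iso (pairsTwo α β γ hrel) rfl⟩)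

theorem isListedFive_of_pairs_of_one_le_norm (hd : Module.finrank ℂ A = 5)
    {Λ : Finset ℂ} {E : ℂ → A} {c : ℂ → ℂ → ℂ} (G : Grading A Λ E c) (hp : c 1 (-1) ≠ 0)
    {m : ℂ} (hm0 : m ≠ 0) (hm1 : m ≠ 1) (hm2 : m ≠ -1) (hr : c m (-m) ≠ 0)
    (hΛ : ∀ l, l ∈ Λ ↔ l = 0 ∨ l = 1 ∨ l = -1 ∨ l = m ∨ l = -m) (hm : 1 ≤ ‖m‖) :
    IsListedFive A := by
  have key : ∀ n : ℂ, (∀ l, l ∈ Λ ↔ l = 0 ∨ l = 1 ∨ l = -1 ∨ l = n ∨ l = -n) → n = 2 →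
      c n (-n) ≠ 0 → IsListedFive A := by
    rintro n hΛ rfl hr
    have e1 : c 2 (-1) * c 1 (-1) - c (-1) (-1) * c 2 (-2) =
        c (-1) 2 * c 1 (-1) - c 2 (-1) * c (-1) 1 := by
      have h := G.left_symm 2 (-1) (-1)
      norm_num at h
      exact h
    have e2 : c (-2) 1 * c (-1) 1 - c 1 1 * c (-2) 2 =
        c 1 (-2) * c (-1) 1 - c (-2) 1 * c 1 (-1) := by
      have h := G.left_symm (-2) 1 1
      norm_num at h
      exact h
    have e3 : c 1 1 * c (-1) 2 = 0 := by
      have h := G.const_mul_const_neg (l := 1) one_ne_zero 1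
      rwa [one_add_one_eq_two] at h
    have e4 : c (-1) (-1) * c 1 (-2) = 0 := by
      have h := G.const_mul_const_neg (l := -1) (by norm_num) (-1)
      norm_num at h ⊢
      exact h
    have e5 : c 2 (-1) * c (-2) 1 = 0 := by
      have h := G.const_mul_const_neg (l := 2) two_ne_zero (-1)
      norm_num at h ⊢
      exact h
    rw [← G.const_neg_comm 1] at e1 e2
    rw [← G.const_neg_comm 2] at e2
    have hcases : (c 1 1 = 0 ∧ c (-2) 1 = 0 ∧ c 1 (-2) = 0) ∨
        (c (-1) (-1) = 0 ∧ c 2 (-1) = 0 ∧ c (-1) 2 = 0) := by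
      grind
    rcases hcases with ⟨h1, h2, h3⟩ | ⟨h1, h2, h3⟩
    · exact isListedFive_of_two hd G hp hr hΛ h1 h2 h3
    · have hneg : (-1 : ℂ) ≠ 0 := by norm_num
      refine isListedFive_of_two hd (G.rescale hneg) ?_ ?_ ?_ ?_ ?_ ?_
      · have h1 := G.const_neg_comm 1
        simpa [div_neg, ← h1] using hp
      · have h1 := G.const_neg_comm 2
        simpa [div_neg, ← h1] using hr
      · intro l
        rw [mem_image_const_mul Λ hneg, hΛ]
        grind
      · simpa [div_neg] using h1
      · simpa [div_neg] using h2
      · simpa [div_neg] using h3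
  by_cases h2 : m = 2
  · exact key m hΛ h2 hr
  by_cases h2' : -m = 2
  · refine key (-m) (fun l => ?_) h2' ?_
    · rw [hΛ, neg_neg]
      tauto
    · rwa [neg_neg, ← G.const_neg_comm]
  have hhalf : 2 * m ≠ 1 := by
    intro h
    have h1 := congrArg norm h
    rw [norm_mul, norm_one, Complex.norm_two] at h1
    linarith
  have hhalf' : 2 * m ≠ -1 := by
    intro h
    have h1 := congrArg norm h
    rw [norm_mul, norm_neg, norm_one, Complex.norm_two] at h1
    linarith
  have hz : ∀ l n : ℂ, (l + n ≠ 0 ∧ l + n ≠ 1 ∧ l + n ≠ -1 ∧ l + n ≠ m ∧ l + n ≠ -m) →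
      E l * E n = 0 := by
    intro l n h
    refine G.mul_eq_zero_of_add ?_
    rw [hΛ]
    tauto
  refine Or.inl ⟨m, hm, hm1, hm2, iso_of_prod_eq_pairsProd (α := 0) (β := 0) (γ := 0) hd G hm0 hm1
    hm2 hp hr ?_ ?_ ?_ ?_ ?_ ?_ ?_ ?_ ?_ ?_ ?_ ?_ _ rfl⟩
  all_goals
    try simp only [zero_mul, zero_smul]
    exact hz _ _ (by refine ⟨?_, ?_, ?_, ?_, ?_⟩ <;> grind)

theorem isListedFive_of_pairs (hd : Module.finrank ℂ A = 5)
    {Λ : Finset ℂ} {E : ℂ → A} {c : ℂ → ℂ → ℂ} (G : Grading A Λ E c) (hp : c 1 (-1) ≠ 0)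
    {m : ℂ} (hm0 : m ≠ 0) (hm1 : m ≠ 1) (hm2 : m ≠ -1) (hr : c m (-m) ≠ 0)
    (hΛ : ∀ l, l ∈ Λ ↔ l = 0 ∨ l = 1 ∨ l = -1 ∨ l = m ∨ l = -m) : IsListedFive A := by
  by_cases hm : 1 ≤ ‖m‖
  · exact isListedFive_of_pairs_of_one_le_norm hd G hp hm0 hm1 hm2 hr hΛ hm
  have hk := inv_ne_zero hm0
  refine isListedFive_of_pairs_of_one_le_norm hd (G.rescale hk) (m := m⁻¹) ?_ hk ?_ ?_ ?_ ?_ ?_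
  · rw [div_inv_eq_mul, div_inv_eq_mul, one_mul, neg_one_mul]
    exact mul_ne_zero hk hr
  · rwa [Ne, inv_eq_one]
  · rwa [Ne, inv_eq_iff_eq_inv, inv_neg, inv_one]
  · rw [neg_div, div_self hk]
    exact mul_ne_zero hk hp
  · intro l
    rw [mem_image_const_mul Λ hk, hΛ, div_inv_eq_mul]
    have h1 : l * m = 0 ↔ l = 0 := by simp [hm0]
    have h2 : l * m = 1 ↔ l = m⁻¹ := mul_eq_one_iff_eq_inv₀ hm0
    have h3 : l * m = -1 ↔ l = -m⁻¹ := by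
      rw [← neg_eq_iff_eq_neg, ← neg_eq_iff_eq_neg, ← neg_mul, mul_eq_one_iff_eq_inv₀ hm0]
    have h4 : l * m = m ↔ l = 1 := by simp [hm0]
    have h5 : l * m = -m ↔ l = -1 := by
      rw [← neg_one_mul m, mul_left_inj' hm0]
    rw [h1, h2, h3, h4, h5]
    constructor <;> rintro (h | h | h | h | h) <;> simp [h]
  · rw [norm_inv]
    exact (one_le_inv₀ (norm_pos_iff.2 hm0)).2 (le_of_not_ge hm)

theorem isListedFive_of_unpaired (hs : IsSimple A) (hd : Module.finrank ℂ A = 5)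
    {Λ : Finset ℂ} {E : ℂ → A} {c : ℂ → ℂ → ℂ} (G : Grading A Λ E c) (hp : c 1 (-1) ≠ 0)
    {n : ℂ} (hn0 : n ≠ 0) (hn1 : n ≠ 1) (hn2 : n ≠ -1) (hn3 : n ≠ 2)
    (hΛ : ∀ l, l ∈ Λ ↔ l = 0 ∨ l = 1 ∨ l = -1 ∨ l = 2 ∨ l = n)
    (h2 : c 2 (-2) = 0) (hn : c n (-n) = 0) (h : c 2 (-1) ≠ 0 ∨ c (-1) 2 ≠ 0) :
    IsListedFive A := by
  obtain ⟨s, hs, t, hst, hc⟩ := G.exists_exit hs (S := {n}) (by simp [hΛ]) (by simp)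
    (by simpa using Ne.symm hn0)
  obtain rfl := Finset.mem_singleton.1 hs
  rw [Finset.mem_singleton] at hst
  have hsum := (hΛ _).1 (G.mem_add_of_or hc)
  have htΛ := (hΛ _).1 (G.mem_of_or hc)
  by_cases hst2 : s + t = 2
  · have hs3 : s = 3 ∧ t = -1 := by
      rcases htΛ with rfl | rfl | rfl | rfl | rfl
      · exact absurd (add_zero _) hst
      · exact absurd (by linear_combination hst2) hn1
      · exact ⟨by linear_combination hst2, rfl⟩
      · exact absurd (by linear_combination hst2) hn0
      · exact absurd (by linear_combination (1 / 2 : ℂ) * hst2) hn1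
    obtain ⟨rfl, rfl⟩ := hs3
    exact Or.inr (Or.inr (iso_chain_of_grading hd G hp hΛ h hc))
  · exfalso
    rcases G.eq_two_or_neg_two hp hn hn0 hc (by tauto) (by
      intro ht
      rcases htΛ with rfl | rfl | rfl | rfl | rfl
      · exact absurd (add_zero _) hst
      · simp
      · simp
      · exact absurd h2 ht
      · exact absurd hn ht) with ⟨rfl, rfl⟩ | ⟨rfl, rfl⟩
    · exact hn3 rfl
    · have e1 : c 2 (-1) * c 1 (-1) - c (-1) (-1) * c 2 (-2) =
          c (-1) 2 * c 1 (-1) - c 2 (-1) * c (-1) 1 := by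
        have h := G.left_symm 2 (-1) (-1)
        norm_num at h
        exact h
      have e2 : c (-2) 1 * c (-1) 1 - c 1 1 * c (-2) 2 =
          c 1 (-2) * c (-1) 1 - c (-2) 1 * c 1 (-1) := by
        have h := G.left_symm (-2) 1 1
        norm_num at h
        exact h
      have e5 : c 2 (-1) * c (-2) 1 = 0 := by
        have h := G.const_mul_const_neg (l := 2) two_ne_zero (-1)
        norm_num at h ⊢
        exact h
      rw [← G.const_neg_comm 1] at e1 e2
      rw [← G.const_neg_comm 2] at e2
      grind

theorem isListedFive [FiniteDimensional ℂ A] (hs : IsSimple A) (hA : HasOneDimCanonicalDecomposition A)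
    (hd : Module.finrank ℂ A = 5) : IsListedFive A := by
  obtain ⟨Λ, E, c, G, hp⟩ := exists_normalized_grading hs hA (by omega)
  have hsub := G.three_subset hp
  obtain ⟨m, n, hmn, hmn'⟩ := Finset.card_eq_two.1
    (show (Λ \ {0, 1, -1}).card = 2 by rw [Finset.card_sdiff_of_subset hsub, card_three, G.card, hd])
  have hΛ : ∀ l, l ∈ Λ ↔ l = 0 ∨ l = 1 ∨ l = -1 ∨ l = m ∨ l = n := by
    intro l
    rw [← Finset.sdiff_union_of_subset hsub, hmn']
    simp only [Finset.mem_union, Finset.mem_singleton, Finset.mem_insert]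
    tauto
  have hm : m ∈ Λ \ {0, 1, -1} := by simp [hmn']
  have hn : n ∈ Λ \ {0, 1, -1} := by simp [hmn']
  simp only [Finset.mem_sdiff, Finset.mem_insert, Finset.mem_singleton, not_or] at hm hn
  obtain ⟨hmΛ, hm0, hm1, hm2⟩ := hm
  obtain ⟨hnΛ, hn0, hn1, hn2⟩ := hn
  by_cases hm : c m (-m) = 0
  swap
  · have h1 := (hΛ _).1 (G.mem_right _ _ hm)
    have h2 : n = -m := by grind
    subst h2
    exact isListedFive_of_pairs hd G hp hm0 hm1 hm2 hm hΛ
  by_cases hn : c n (-n) = 0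
  swap
  · have h1 := (hΛ _).1 (G.mem_right _ _ hn)
    have h2 : m = -n := by grind
    subst h2
    refine isListedFive_of_pairs hd G hp hn0 hn1 hn2 hn fun l => ?_
    rw [hΛ]
    tauto
  obtain ⟨s, hsS, t, hst, h⟩ := G.exists_exit hs (S := {m, n}) (by
    intro l hl
    rw [Finset.mem_insert, Finset.mem_singleton] at hl
    rcases hl with rfl | rfl
    · exact hmΛ
    · exact hnΛ) (by simp) (by simp [Ne.symm hm0, Ne.symm hn0])
  wlog hsm : s = m generalizing m n
  · refine this n m hmn.symm ?_ ?_ hnΛ hn0 hn1 hn2 hmΛ hm0 hm1 hm2 hn hm ?_ ?_ ?_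
    · rw [hmn', Finset.pair_comm]
    · intro l
      rw [hΛ]
      tauto
    · rwa [Finset.pair_comm]
    · rwa [Finset.pair_comm]
    · rw [Finset.mem_insert, Finset.mem_singleton] at hsS
      exact hsS.resolve_left hsm
  subst hsm
  have hsum := (hΛ _).1 (G.mem_add_of_or h)
  have htΛ := (hΛ _).1 (G.mem_of_or h)
  rw [Finset.mem_insert, Finset.mem_singleton, not_or] at hst
  rcases G.eq_two_or_neg_two hp hm hm0 h (by tauto) (by
    intro ht
    rcases htΛ with rfl | rfl | rfl | rfl | rfl
    · exact absurd (add_zero _) hst.1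
    · simp
    · simp
    · exact absurd hm ht
    · exact absurd hn ht) with ⟨rfl, rfl⟩ | ⟨rfl, rfl⟩
  · exact isListedFive_of_unpaired hs hd G hp hn0 hn1 hn2 (Ne.symm hmn) hΛ hm hn h
  · have hneg : (-1 : ℂ) ≠ 0 := by norm_num
    refine isListedFive_of_unpaired (n := -n) hs hd (G.rescale hneg) ?_ ?_ ?_ ?_ ?_ ?_ ?_ ?_ ?_
    · have h1 := G.const_neg_comm 1
      simpa [div_neg, ← h1] using hp
    · simpa using hn0
    · grind
    · grind
    · grind
    · intro l
      rw [mem_image_const_mul Λ hneg, hΛ]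
      grind
    · simpa [div_neg] using hm
    · simpa [div_neg] using hn
    · simpa [div_neg] using h

end DimensionFive

section TableBases

variable {n : ℕ}

/-- The standard basis of the algebra of a table. -/
noncomputable def Table.basis (T : Table n) : Module.Basis (Fin n) ℂ T.Alg :=
  Pi.basisFun ℂ (Fin n)

theorem Table.finrank_alg (T : Table n) : Module.finrank ℂ T.Alg = n := by
  rw [Module.finrank_eq_card_basis T.basis, Fintype.card_fin]

theorem Table.basis_mul (T : Table n) (i j : Fin n) :
    T.basis i * T.basis j = ∑ k, T.prod i j k • T.basis k := by
  have h1 : T.basis i * T.basis j = T.prod i j := by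
    change tableMul T.prod ((Pi.basisFun ℂ (Fin n)) i) ((Pi.basisFun ℂ (Fin n)) j) = T.prod i j
    simp [tableMul, Pi.single_apply]
  rw [h1]
  exact (T.basis.sum_repr (T.prod i j)).symm

theorem Table.basis_mul_of_prod_eq (T : Table n) {i j k : Fin n} {a : ℂ}
    (h : T.prod i j = a • e k) : T.basis i * T.basis j = a • T.basis k := by
  rw [T.basis_mul, h, Finset.sum_eq_single k]
  · simp [e]
  · intro l _ hl
    simp [e, hl]
  · simp

theorem Table.basis_mul_of_prod_eq_zero (T : Table n) {i j : Fin n}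
    (h : T.prod i j = 0) : T.basis i * T.basis j = 0 := by
  simp [T.basis_mul, h]

theorem Table.exists_affine_of_nilpotent (T : Table n) (P : (Fin n → ℂ) → Prop)
    (x y : Fin n → ℂ)
    (hx : ∀ z, tableMul T.prod x (tableMul T.prod x (tableMul T.prod x
      (tableMul T.prod x z + x))) = 0)
    (hP : P (y + (tableMul T.prod x y + x) +
      (1 / 2 : ℂ) • (tableMul T.prod x (tableMul T.prod x y + x)) +
      (1 / 6 : ℂ) • (tableMul T.prod x (tableMul T.prod x (tableMul T.prod x y + x))))) :
    ∃ g ∈ affineGroup T.Alg, P (g y) := by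
  obtain ⟨g, hg, h⟩ := exists_mem_affineGroup_of_nilpotent (A := T.Alg) (x := x) hx
  exact ⟨g, hg, (h y).symm ▸ hP⟩

/-- If a point can be moved so as to satisfy `P`, and `P` implies `Q` after the flow of a
nilpotent field, then the point can be moved so as to satisfy `Q`. -/
theorem Table.exists_affine_trans (T : Table n) (y : Fin n → ℂ) (P Q : (Fin n → ℂ) → Prop)
    (h : ∃ g ∈ affineGroup T.Alg, P (g y)) (x : (Fin n → ℂ) → Fin n → ℂ)
    (hx : ∀ u z, tableMul T.prod (x u) (tableMul T.prod (x u) (tableMul T.prod (x u)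
      (tableMul T.prod (x u) z + x u))) = 0)
    (hP : ∀ u, P u → Q (u + (tableMul T.prod (x u) u + x u) +
      (1 / 2 : ℂ) • (tableMul T.prod (x u) (tableMul T.prod (x u) u + x u)) +
      (1 / 6 : ℂ) • (tableMul T.prod (x u) (tableMul T.prod (x u)
        (tableMul T.prod (x u) u + x u))))) :
    ∃ g ∈ affineGroup T.Alg, Q (g y) := by
  obtain ⟨g, hg, hy⟩ := h
  obtain ⟨k, hk, hz⟩ := T.exists_affine_of_nilpotent Q (x (g y)) (g y) (hx _) (hP _ hy)
  exact ⟨k * g, mul_mem hk hg, hz⟩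

/-- The first basis vector acts on the basis with distinct eigenvalues, the first of them zero,
and annihilates from the right. -/
structure Table.IsGraded {n : ℕ} (T : Table (n + 1)) (w : Fin (n + 1) → ℂ) : Prop where
  left : ∀ i, T.prod 0 i = w i • e i
  right : ∀ i, T.prod i 0 = 0
  zero : w 0 = 0
  injective : Function.Injective w

namespace Table.IsGraded

variable {T : Table (n + 1)} {w : Fin (n + 1) → ℂ} (hT : T.IsGraded w)
include hT

theorem basis_left (i : Fin (n + 1)) : T.basis 0 * T.basis i = w i • T.basis i :=
  T.basis_mul_of_prod_eq (hT.left i)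

theorem basis_right (i : Fin (n + 1)) : T.basis i * T.basis 0 = 0 :=
  T.basis_mul_of_prod_eq_zero (hT.right i)

theorem hasOneDimCanonicalDecomposition : HasOneDimCanonicalDecomposition T.Alg :=
  hasOneDimCanonicalDecomposition_of_eigenbasis T.basis hT.basis_left hT.basis_right hT.zero
    hT.injective

theorem isComplete (h : ∀ y : Fin (n + 1) → ℂ, ∃ g ∈ affineGroup T.Alg, ∀ i : Fin n,
    (g y : Fin (n + 1) → ℂ) i.succ = 0) :
    IsComplete T.Alg := by
  refine isComplete_of_eigenbasis T.basis hT.basis_left hT.zero fun y => ?_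
  obtain ⟨g, hg, hy⟩ := h y
  refine ⟨g, hg, (g y : Fin (n + 1) → ℂ) 0, ?_⟩
  have h1 : T.basis 0 = (Pi.single 0 1 : Fin (n + 1) → ℂ) := Pi.basisFun_apply ℂ (Fin (n + 1)) 0
  rw [h1]
  refine funext fun i => ?_
  change (g y : Fin (n + 1) → ℂ) i =
    ((g y : Fin (n + 1) → ℂ) 0 • (Pi.single 0 1 : Fin (n + 1) → ℂ)) i
  refine Fin.cases ?_ (fun i => ?_) i
  · simp
  · rw [hy]
    simp

theorem isSimple (h : ∀ J : Submodule ℂ T.Alg, IsIdeal J → ∀ i, T.basis i ∈ J → T.basis 0 ∈ J) :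
    IsSimple T.Alg :=
  isSimple_of_eigenbasis T.basis hT.basis_left hT.zero hT.injective h

end Table.IsGraded

theorem Table.mem_of_prod_eq (T : Table n) {J : Submodule ℂ T.Alg} (hJ : IsIdeal J)
    {i : Fin n} (hi : T.basis i ∈ J) (j : Fin n) {k : Fin n} (h : T.prod i j = e k) :
    T.basis k ∈ J := by
  have h1 := T.basis_mul_of_prod_eq (a := 1) (by rw [h, one_smul])
  rw [one_smul] at h1
  exact h1 ▸ (hJ _ hi (T.basis j)).1

end TableBases

section Members

theorem isGraded_auslander : auslander.IsGraded ![0, 1, -1] where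
  left i := by fin_cases i <;> simp [auslander]
  right i := by fin_cases i <;> simp [auslander]
  zero := rfl
  injective i j := by fin_cases i <;> fin_cases j <;> norm_num

theorem tableMul_auslander (x y : Fin 3 → ℂ) : tableMul auslander.prod x y =
    ![x 1 * y 2 + x 2 * y 1, x 0 * y 1, -(x 0 * y 2)] := by
  ext k
  fin_cases k <;> simp [auslander, tableMul, e, Fin.sum_univ_three]

theorem isSimpleCompleteOneDim_auslander : IsSimpleCompleteOneDim auslander.Alg where
  oneDim := isGraded_auslander.hasOneDimCanonicalDecomposition
  simple := by
    refine isGraded_auslander.isSimple fun J hJ i hi => ?_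
    fin_cases i
    · exact hi
    · exact auslander.mem_of_prod_eq hJ hi 2 (by simp [auslander])
    · exact auslander.mem_of_prod_eq hJ hi 1 (by simp [auslander])
  complete := by
    refine isGraded_auslander.isComplete fun y => ?_
    have s0 := auslander.exists_affine_of_nilpotent (fun u => u 1 = 0) ![0, -y 1, 0] y
      (fun z => by ext i; fin_cases i <;> simp [tableMul_auslander])
      (by simp [tableMul_auslander, Matrix.vecHead, Matrix.vecTail])
    exact auslander.exists_affine_trans y (fun u => u 1 = 0)
      (fun u => ∀ i : Fin 2, u i.succ = 0) s0 (fun u => ![0, 0, -u 2])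
      (fun u z => by ext i; fin_cases i <;> simp [tableMul_auslander])
      (fun u hu i => by fin_cases i <;> simp [tableMul_auslander, hu, Matrix.vecHead, Matrix.vecTail])

theorem isGraded_dimFour : dimFour.IsGraded ![0, -1, 1, 2] where
  left i := by fin_cases i <;> simp [dimFour]
  right i := by fin_cases i <;> simp [dimFour]
  zero := rfl
  injective i j := by fin_cases i <;> fin_cases j <;> norm_num

theorem tableMul_dimFour (x y : Fin 4 → ℂ) : tableMul dimFour.prod x y =
    ![x 1 * y 2 + x 2 * y 1, -(x 0 * y 1), x 0 * y 2 + 2 * (x 1 * y 3) + x 3 * y 1,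
      2 * (x 0 * y 3)] := by
  ext k
  fin_cases k <;> simp [dimFour, tableMul, e, Fin.sum_univ_four] <;> ring

theorem isSimpleCompleteOneDim_dimFour : IsSimpleCompleteOneDim dimFour.Alg where
  oneDim := isGraded_dimFour.hasOneDimCanonicalDecomposition
  simple := by
    refine isGraded_dimFour.isSimple fun J hJ i hi => ?_
    have h2 : dimFour.basis 2 ∈ J → dimFour.basis 0 ∈ J := fun h =>
      dimFour.mem_of_prod_eq hJ h 1 (by simp [dimFour])
    fin_cases i
    · exact hi
    · exact dimFour.mem_of_prod_eq hJ hi 2 (by simp [dimFour])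
    · exact h2 hi
    · exact h2 (dimFour.mem_of_prod_eq hJ hi 1 (by simp [dimFour]))
  complete := by
    refine isGraded_dimFour.isComplete fun y => ?_
    have s0 := dimFour.exists_affine_of_nilpotent (fun u => u 3 = 0) ![0, 0, 0, -y 3] y
      (fun z => by ext i; fin_cases i <;> simp [tableMul_dimFour])
      (by simp [tableMul_dimFour, Matrix.vecHead, Matrix.vecTail])
    have s1 := dimFour.exists_affine_trans y (fun u => u 3 = 0)
      (fun u => u 1 = 0 ∧ u 3 = 0) s0 (fun u => ![0, -u 1, 0, 0])
      (fun u z => by ext i; fin_cases i <;> simp [tableMul_dimFour])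
      (fun u hu => by simp [tableMul_dimFour, hu, Matrix.vecHead, Matrix.vecTail])
    exact dimFour.exists_affine_trans y (fun u => u 1 = 0 ∧ u 3 = 0)
      (fun u => ∀ i : Fin 3, u i.succ = 0) s1 (fun u => ![0, 0, -u 2, 0])
      (fun u z => by ext i; fin_cases i <;> simp [tableMul_dimFour])
      (fun u hu i => by fin_cases i <;> simp [tableMul_dimFour, hu, Matrix.vecHead, Matrix.vecTail])

theorem isGraded_of_prod_eq_pairsProd {l α β γ : ℂ} (hl0 : l ≠ 0) (hl1 : l ≠ 1) (hl2 : l ≠ -1)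
    {T : Table 5} (hT : T.prod = pairsProd l α β γ) : T.IsGraded ![0, 1, -1, l, -l] where
  left i := by rw [hT]; fin_cases i <;> simp [pairsProd]
  right i := by rw [hT]; fin_cases i <;> simp [pairsProd]
  zero := rfl
  injective i j h := by
    have h1 : -l ≠ 1 := fun h => hl2 (by linear_combination -h)
    have h2 : -l ≠ -1 := fun h => hl1 (by linear_combination -h)
    have h3 : l ≠ -l := fun h => hl0 (by linear_combination (1 / 2 : ℂ) * h)
    have h4 : (1 : ℂ) ≠ -1 := by norm_num
    fin_cases i <;> fin_cases j <;>
      simp [hl0, hl1, hl2, hl0.symm, hl1.symm, hl2.symm, h1, h2, h3, h4, h1.symm, h2.symm, h3.symm,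
        h4.symm] at h ⊢

theorem isSimpleCompleteOneDim_of_prod_eq_pairsProd {l α β γ : ℂ} (hl0 : l ≠ 0) (hl1 : l ≠ 1)
    (hl2 : l ≠ -1) {T : Table 5} (hT : T.prod = pairsProd l α β γ) :
    IsSimpleCompleteOneDim T.Alg where
  oneDim := (isGraded_of_prod_eq_pairsProd hl0 hl1 hl2 hT).hasOneDimCanonicalDecomposition
  simple := by
    refine (isGraded_of_prod_eq_pairsProd hl0 hl1 hl2 hT).isSimple fun J hJ i hi => ?_
    fin_cases i
    · exact hi
    · exact T.mem_of_prod_eq hJ hi 2 (by simp [hT, pairsProd])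
    · exact T.mem_of_prod_eq hJ hi 1 (by simp [hT, pairsProd])
    · exact T.mem_of_prod_eq hJ hi 4 (by simp [hT, pairsProd])
    · exact T.mem_of_prod_eq hJ hi 3 (by simp [hT, pairsProd])
  complete := by
    refine (isGraded_of_prod_eq_pairsProd hl0 hl1 hl2 hT).isComplete fun y => ?_
    have s0 := T.exists_affine_of_nilpotent (fun u => u 3 = 0) ![0, 0, 0, -y 3, 0] y
      (fun z => by ext i; fin_cases i <;> simp [hT, tableMul_pairsProd])
      (by simp [hT, tableMul_pairsProd, Matrix.vecHead, Matrix.vecTail])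
    have s1 := T.exists_affine_trans y (fun u => u 3 = 0)
      (fun u => u 2 = 0 ∧ u 3 = 0) s0 (fun u => ![0, 0, -u 2, 0, 0])
      (fun u z => by ext i; fin_cases i <;> simp [hT, tableMul_pairsProd])
      (fun u hu => by simp [hT, tableMul_pairsProd, hu, Matrix.vecHead, Matrix.vecTail])
    have s2 := T.exists_affine_trans y (fun u => u 2 = 0 ∧ u 3 = 0)
      (fun u => u 2 = 0 ∧ u 3 = 0 ∧ u 4 = 0) s1 (fun u => ![0, 0, 0, 0, -u 4])
      (fun u z => by ext i; fin_cases i <;> simp [hT, tableMul_pairsProd])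
      (fun u hu => by simp [hT, tableMul_pairsProd, hu, Matrix.vecHead, Matrix.vecTail])
    exact T.exists_affine_trans y (fun u => u 2 = 0 ∧ u 3 = 0 ∧ u 4 = 0)
      (fun u => ∀ i : Fin 4, u i.succ = 0) s2 (fun u => ![0, -u 1, 0, 0, 0])
      (fun u z => by ext i; fin_cases i <;> simp [hT, tableMul_pairsProd])
      (fun u hu i => by fin_cases i <;> simp [hT, tableMul_pairsProd, hu, Matrix.vecHead, Matrix.vecTail])

theorem isGraded_chain : chain.IsGraded ![0, -1, 1, 2, 3] where
  left i := by fin_cases i <;> simp [chain, chainProd]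
  right i := by fin_cases i <;> simp [chain, chainProd]
  zero := rfl
  injective i j := by fin_cases i <;> fin_cases j <;> norm_num

theorem isSimpleCompleteOneDim_chain : IsSimpleCompleteOneDim chain.Alg where
  oneDim := isGraded_chain.hasOneDimCanonicalDecomposition
  simple := by
    refine isGraded_chain.isSimple fun J hJ i hi => ?_
    have h2 : chain.basis 2 ∈ J → chain.basis 0 ∈ J := fun h =>
      chain.mem_of_prod_eq hJ h 1 (by simp [chain, chainProd])
    have h3 : chain.basis 3 ∈ J → chain.basis 0 ∈ J := fun h =>
      h2 (chain.mem_of_prod_eq hJ h 1 (by simp [chain, chainProd]))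
    fin_cases i
    · exact hi
    · exact chain.mem_of_prod_eq hJ hi 2 (by simp [chain, chainProd])
    · exact h2 hi
    · exact h3 hi
    · exact h3 (chain.mem_of_prod_eq hJ hi 1 (by simp [chain, chainProd]))
  complete := by
    have hT : chain.prod = chainProd := rfl
    refine isGraded_chain.isComplete fun y => ?_
    have s0 := chain.exists_affine_of_nilpotent (fun u => u 4 = 0) ![0, 0, 0, 0, -y 4] y
      (fun z => by ext i; fin_cases i <;> simp [hT, tableMul_chainProd])
      (by simp [hT, tableMul_chainProd, Matrix.vecHead, Matrix.vecTail])
    have s1 := chain.exists_affine_trans y (fun u => u 4 = 0)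
      (fun u => u 3 = 0 ∧ u 4 = 0) s0 (fun u => ![0, 0, 0, -u 3, 0])
      (fun u z => by ext i; fin_cases i <;> simp [hT, tableMul_chainProd])
      (fun u hu => by simp [hT, tableMul_chainProd, hu, Matrix.vecHead, Matrix.vecTail])
    have s2 := chain.exists_affine_trans y (fun u => u 3 = 0 ∧ u 4 = 0)
      (fun u => u 1 = 0 ∧ u 3 = 0 ∧ u 4 = 0) s1 (fun u => ![0, -u 1, 0, 0, 0])
      (fun u z => by ext i; fin_cases i <;> simp [hT, tableMul_chainProd])
      (fun u hu => by simp [hT, tableMul_chainProd, hu, Matrix.vecHead, Matrix.vecTail])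
    exact chain.exists_affine_trans y (fun u => u 1 = 0 ∧ u 3 = 0 ∧ u 4 = 0)
      (fun u => ∀ i : Fin 4, u i.succ = 0) s2 (fun u => ![0, 0, -u 2, 0, 0])
      (fun u z => by ext i; fin_cases i <;> simp [hT, tableMul_chainProd])
      (fun u hu i => by fin_cases i <;> simp [hT, tableMul_chainProd, hu, Matrix.vecHead, Matrix.vecTail])

end Members

section Isomorphisms

theorem Iso.symm {A B : Type*} [LeftPreLieRing A] [LeftPreLieAlgebra ℂ A] [LeftPreLieRing B]
    [LeftPreLieAlgebra ℂ B] (h : Iso A B) : Iso B A := by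
  obtain ⟨f, hf⟩ := h
  refine ⟨f.symm, fun x y => f.injective ?_⟩
  rw [hf]
  simp only [LinearEquiv.apply_symm_apply]

theorem Iso.trans {A B C : Type*} [LeftPreLieRing A] [LeftPreLieAlgebra ℂ A] [LeftPreLieRing B]
    [LeftPreLieAlgebra ℂ B] [LeftPreLieRing C] [LeftPreLieAlgebra ℂ C] (h : Iso A B)
    (h' : Iso B C) : Iso A C := by
  obtain ⟨f, hf⟩ := h
  obtain ⟨g, hg⟩ := h'
  exact ⟨f.trans g, fun x y => by simp [hf, hg]⟩

/-- An isomorphism preserves the distinguished basis vectors up to scalars, and preserves the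
weights up to a common scalar. -/
theorem Table.IsGraded.exists_scale {m n : ℕ} {S : Table (m + 1)} {T : Table (n + 1)}
    {v : Fin (m + 1) → ℂ} {w : Fin (n + 1) → ℂ} (hS : S.IsGraded v) (hT : T.IsGraded w)
    {f : S.Alg ≃ₗ[ℂ] T.Alg} (hf : ∀ x y, f (x * y) = f x * f y) :
    ∃ k : ℂ, k ≠ 0 ∧ f (S.basis 0) = k • T.basis 0 ∧
      ∀ i, ∃ j, ∃ s : ℂ, s ≠ 0 ∧ f (S.basis i) = s • T.basis j ∧ v i = k * w j := by
  have hz : T.basis 0 * f (S.basis 0) = 0 := by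
    obtain ⟨x, hx⟩ := f.surjective (T.basis 0)
    rw [← hx, ← hf, ← S.basis.sum_repr x, Finset.sum_mul, Finset.sum_eq_zero, map_zero]
    intro i _
    rw [smul_mul_assoc, hS.basis_right, smul_zero]
  have hw : ∀ j, j ≠ 0 → w j ≠ 0 := fun j hj h0 => hj (hT.injective (h0.trans hT.zero.symm))
  set k := T.basis.repr (f (S.basis 0)) 0 with hk
  have hfk : f (S.basis 0) = k • T.basis 0 := by
    conv_lhs => rw [← T.basis.sum_repr (f (S.basis 0))]
    refine Finset.sum_eq_single 0 (fun j _ hj => ?_) (by simp)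
    have h1 := repr_mul_of_eigenbasis T.basis hT.basis_left (f (S.basis 0)) j
    rw [hz, map_zero, Finsupp.coe_zero, Pi.zero_apply, eq_comm] at h1
    rw [(mul_eq_zero.1 h1).resolve_left (hw j hj), zero_smul]
  have hk0 : k ≠ 0 := by
    intro h0
    rw [h0, zero_smul, LinearEquiv.map_eq_zero_iff] at hfk
    exact S.basis.ne_zero 0 hfk
  refine ⟨k, hk0, hfk, fun i => ?_⟩
  have hrepr : ∀ j, k * w j * T.basis.repr (f (S.basis i)) j =
      v i * T.basis.repr (f (S.basis i)) j := by
    intro j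
    have h1 : k • (T.basis 0 * f (S.basis i)) = v i • f (S.basis i) := by
      rw [← smul_mul_assoc, ← hfk, ← hf, hS.basis_left, map_smul]
    have h2 := congrArg (fun z => T.basis.repr z j) h1
    simp only [map_smul, Finsupp.coe_smul, Pi.smul_apply, smul_eq_mul,
      repr_mul_of_eigenbasis T.basis hT.basis_left] at h2
    rw [mul_assoc, h2]
  have hne : f (S.basis i) ≠ 0 := by
    rw [Ne, LinearEquiv.map_eq_zero_iff]
    exact S.basis.ne_zero i
  obtain ⟨j, hj⟩ : ∃ j, T.basis.repr (f (S.basis i)) j ≠ 0 := by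
    by_contra hcon
    push Not at hcon
    exact hne (T.basis.repr.injective (by ext j; simp [hcon j]))
  have hvi : v i = k * w j := (mul_right_cancel₀ hj (hrepr j)).symm
  refine ⟨j, _, hj, ?_, hvi⟩
  conv_lhs => rw [← T.basis.sum_repr (f (S.basis i))]
  refine Finset.sum_eq_single j (fun l _ hl => ?_) (by simp)
  by_contra h0
  have h1 : T.basis.repr (f (S.basis i)) l ≠ 0 := fun h => h0 (by rw [h, zero_smul])
  have h2 := mul_right_cancel₀ h1 (hrepr l)
  rw [hvi] at h2
  exact hl (hT.injective (mul_left_cancel₀ hk0 h2))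

theorem pairs_prod (l : ℂ) : (pairs l).prod = pairsProd l 0 0 0 := rfl

theorem pairsTwo_prod {α β γ : ℂ} (h : 2 * α = β + γ) :
    (pairsTwo α β γ h).prod = pairsProd 2 α β γ := rfl

theorem iso_pairs_neg {l : ℂ} (hl0 : l ≠ 0) (hl1 : l ≠ 1) (hl2 : l ≠ -1) :
    Iso (pairs l).Alg (pairs (-l)).Alg := by
  have hG := isGraded_of_prod_eq_pairsProd hl0 hl1 hl2 (T := pairs l) rfl
  have hG' := isGraded_of_prod_eq_pairsProd (l := -l) (neg_ne_zero.2 hl0)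
    (fun h => hl2 (by rw [← h, neg_neg])) (fun h => hl1 (neg_injective h)) (T := pairs (-l)) rfl
  set b := (pairs l).basis with hb
  refine iso_of_eigenbasis (pairs (-l)) (x := b 0) (w := ![0, 1, -1, -l, - -l])
    (v := ![b 0, b 1, b 2, b 4, b 3]) (pairs l).finrank_alg hG'.injective ?_ ?_ ?_
  · intro i
    fin_cases i <;> exact b.ne_zero _
  · intro i
    fin_cases i
    · exact hG.basis_left 0
    · exact hG.basis_left 1
    · exact hG.basis_left 2
    · exact hG.basis_left 4
    · simpa using hG.basis_left 3
  · intro i j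
    fin_cases i <;> fin_cases j <;>
      simp [hb, Table.basis_mul, Fin.sum_univ_five, pairs_prod, pairsProd, e]

theorem iso_pairs_inv {l : ℂ} (hl0 : l ≠ 0) (hl1 : l ≠ 1) (hl2 : l ≠ -1) :
    Iso (pairs l).Alg (pairs l⁻¹).Alg := by
  have hG := isGraded_of_prod_eq_pairsProd hl0 hl1 hl2 (T := pairs l) rfl
  have hG' := isGraded_of_prod_eq_pairsProd (l := l⁻¹) (inv_ne_zero hl0)
    (by rwa [Ne, inv_eq_one]) (by rwa [Ne, inv_eq_iff_eq_inv, inv_neg, inv_one])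
    (T := pairs l⁻¹) rfl
  set b := (pairs l).basis with hb
  refine iso_of_eigenbasis (pairs l⁻¹) (x := l⁻¹ • b 0) (w := ![0, 1, -1, l⁻¹, -l⁻¹])
    (v := ![l⁻¹ • b 0, b 3, l⁻¹ • b 4, b 1, l⁻¹ • b 2]) (pairs l).finrank_alg hG'.injective
    ?_ ?_ ?_
  · intro i
    fin_cases i
    · exact smul_ne_zero (inv_ne_zero hl0) (b.ne_zero _)
    · exact b.ne_zero _
    · exact smul_ne_zero (inv_ne_zero hl0) (b.ne_zero _)
    · exact b.ne_zero _
    · exact smul_ne_zero (inv_ne_zero hl0) (b.ne_zero _)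
  · intro i
    fin_cases i <;>
      simp [hb, Table.basis_mul, Fin.sum_univ_five, pairs_prod, pairsProd, e, smul_mul_assoc,
        mul_smul_comm, smul_smul, hl0]
  · intro i j
    fin_cases i <;> fin_cases j <;>
      simp [hb, Table.basis_mul, Fin.sum_univ_five, pairs_prod, pairsProd, e, smul_mul_assoc,
        mul_smul_comm, smul_smul, hl0]

theorem iso_pairs_iff {l m : ℂ} (hl0 : l ≠ 0) (hl1 : l ≠ 1) (hl2 : l ≠ -1) (hm0 : m ≠ 0)
    (hm1 : m ≠ 1) (hm2 : m ≠ -1) :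
    Iso (pairs l).Alg (pairs m).Alg ↔ m = l ∨ m = -l ∨ m = l⁻¹ ∨ m = -l⁻¹ := by
  constructor
  · rintro ⟨f, hf⟩
    obtain ⟨k, hk, -, h⟩ := (isGraded_of_prod_eq_pairsProd hl0 hl1 hl2 (T := pairs l)
      rfl).exists_scale (isGraded_of_prod_eq_pairsProd hm0 hm1 hm2 (T := pairs m) rfl) hf
    obtain ⟨i, -, -, -, hi⟩ := h 1
    obtain ⟨j, -, -, -, hj⟩ := h 3
    have h1 : k = 1 ∨ k = -1 ∨ k * m = 1 ∨ k * m = -1 := by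
      fin_cases i <;> simp at hi <;> grind
    have h2 : l = k ∨ l = -k ∨ l = k * m ∨ l = -(k * m) := by
      fin_cases j <;> simp at hj <;> grind
    have h3 : m = l ∨ m = -l ∨ m * l = 1 ∨ -m * l = 1 := by
      rcases h1 with h1 | h1 | h1 | h1 <;> rcases h2 with h2 | h2 | h2 | h2
      · exact absurd (by linear_combination h2 + h1) hl1
      · exact absurd (by linear_combination h2 - h1) hl2
      · exact Or.inl (by linear_combination -h2 - m * h1)
      · exact Or.inr (Or.inl (by linear_combination h2 - m * h1))
      · exact absurd (by linear_combination h2 + h1) hl2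
      · exact absurd (by linear_combination h2 - h1) hl1
      · exact Or.inr (Or.inl (by linear_combination h2 + m * h1))
      · exact Or.inl (by linear_combination -h2 + m * h1)
      · exact Or.inr (Or.inr (Or.inl (by linear_combination m * h2 + h1)))
      · exact Or.inr (Or.inr (Or.inr (by linear_combination -m * h2 + h1)))
      · exact absurd (by linear_combination h2 + h1) hl1
      · exact absurd (by linear_combination h2 - h1) hl2
      · exact Or.inr (Or.inr (Or.inr (by linear_combination -m * h2 - h1)))
      · exact Or.inr (Or.inr (Or.inl (by linear_combination m * h2 - h1)))
      · exact absurd (by linear_combination h2 + h1) hl2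
      · exact absurd (by linear_combination h2 - h1) hl1
    rw [mul_eq_one_iff_eq_inv₀ hl0, mul_eq_one_iff_eq_inv₀ hl0] at h3
    rcases h3 with h | h | h | h
    · exact Or.inl h
    · exact Or.inr (Or.inl h)
    · exact Or.inr (Or.inr (Or.inl h))
    · exact Or.inr (Or.inr (Or.inr (by rw [← h, neg_neg])))
  · have hinv1 : l⁻¹ ≠ 1 := by rwa [Ne, inv_eq_one]
    have hinv2 : l⁻¹ ≠ -1 := by rwa [Ne, inv_eq_iff_eq_inv, inv_neg, inv_one]
    rintro (rfl | rfl | rfl | rfl)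
    · exact ⟨LinearEquiv.refl ℂ _, fun _ _ => rfl⟩
    · exact iso_pairs_neg hl0 hl1 hl2
    · exact iso_pairs_inv hl0 hl1 hl2
    · exact (iso_pairs_inv hl0 hl1 hl2).trans (iso_pairs_neg (inv_ne_zero hl0) hinv1 hinv2)

theorem isGraded_pairsTwo {α β γ : ℂ} (h : 2 * α = β + γ) :
    (pairsTwo α β γ h).IsGraded ![0, 1, -1, 2, -2] :=
  isGraded_of_prod_eq_pairsProd two_ne_zero (by norm_num) (by norm_num) rfl

theorem iso_pairsTwo_smul {α β γ c : ℂ} (hc : c ≠ 0) (h : 2 * α = β + γ)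
    (h' : 2 * (c * α) = c * β + c * γ) :
    Iso (pairsTwo α β γ h).Alg (pairsTwo (c * α) (c * β) (c * γ) h').Alg := by
  have hG' := isGraded_pairsTwo h'
  set b := (pairsTwo α β γ h).basis with hb
  refine iso_of_eigenbasis (pairsTwo (c * α) (c * β) (c * γ) h') (x := b 0)
    (w := ![0, 1, -1, 2, -2]) (v := ![b 0, b 1, b 2, c • b 3, c⁻¹ • b 4])
    (pairsTwo α β γ h).finrank_alg hG'.injective ?_ ?_ ?_
  · intro i
    fin_cases i
    · exact b.ne_zero _
    · exact b.ne_zero _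
    · exact b.ne_zero _
    · exact smul_ne_zero hc (b.ne_zero _)
    · exact smul_ne_zero (inv_ne_zero hc) (b.ne_zero _)
  · intro i
    fin_cases i <;>
      simp [hb, Table.basis_mul, Fin.sum_univ_five, pairsTwo_prod, pairsProd, e, mul_smul_comm,
        smul_smul, mul_comm]
  · intro i j
    fin_cases i <;> fin_cases j <;>
      simp [hb, Table.basis_mul, Fin.sum_univ_five, pairsTwo_prod, pairsProd, e, smul_mul_assoc,
        mul_smul_comm, smul_smul, mul_inv_cancel₀ hc, inv_mul_cancel₀ hc] <;> field_simp

theorem Table.smul_basis_inj {n : ℕ} (T : Table n) (i : Fin n) {r s : ℂ}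
    (h : r • T.basis i = s • T.basis i) : r = s :=
  smul_left_injective ℂ (T.basis.ne_zero i) h

theorem iso_pairsTwo_iff {α β γ α' β' γ' : ℂ} (h : 2 * α = β + γ) (h' : 2 * α' = β' + γ')
    (h0 : (α, β, γ) ≠ 0) :
    Iso (pairsTwo α β γ h).Alg (pairsTwo α' β' γ' h').Alg ↔
      ∃ c : ℂ, c ≠ 0 ∧ (α', β', γ') = c • (α, β, γ) := by
  constructor
  · rintro ⟨f, hf⟩
    obtain ⟨k, hk, hk0, hs⟩ := (isGraded_pairsTwo h).exists_scale (isGraded_pairsTwo h') hf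
    obtain ⟨i1, s1, hs1, hf1, hi1⟩ := hs 1
    obtain ⟨i2, s2, hs2, hf2, hi2⟩ := hs 2
    obtain ⟨i3, s3, hs3, hf3, hi3⟩ := hs 3
    obtain ⟨i4, s4, hs4, hf4, hi4⟩ := hs 4
    have hk1 : k = 1 ∨ k = -1 := by
      fin_cases i1 <;> fin_cases i3 <;> simp at hi1 hi3 <;> grind
    set b := (pairsTwo α β γ h).basis with hb
    set b' := (pairsTwo α' β' γ' h').basis with hb'
    have p12 : b 1 * b 2 = b 0 := by
      simp [hb, Table.basis_mul, pairsTwo_prod, pairsProd, e]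
    have p34 : b 3 * b 4 = b 0 := by
      simp [hb, Table.basis_mul, pairsTwo_prod, pairsProd, e]
    have p32 : b 3 * b 2 = α • b 1 := by
      simp [hb, Table.basis_mul, Fin.sum_univ_five, pairsTwo_prod, pairsProd, e]
    have p23 : b 2 * b 3 = β • b 1 := by
      simp [hb, Table.basis_mul, Fin.sum_univ_five, pairsTwo_prod, pairsProd, e]
    have p22 : b 2 * b 2 = γ • b 4 := by
      simp [hb, Table.basis_mul, Fin.sum_univ_five, pairsTwo_prod, pairsProd, e]
    have e12 := congrArg f p12
    have e34 := congrArg f p34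
    have e32 := congrArg f p32
    have e23 := congrArg f p23
    have e22 := congrArg f p22
    rw [hf, hf1, hf2, hk0] at e12
    rw [hf, hf3, hf4, hk0] at e34
    rw [hf, hf3, hf2, map_smul, hf1] at e32
    rw [hf, hf2, hf3, map_smul, hf1] at e23
    rw [hf, hf2, map_smul, hf4] at e22
    have hinj := (isGraded_pairsTwo h').injective
    rcases hk1 with rfl | rfl
    · have j1 : i1 = 1 := hinj (hi1.trans (one_mul _)).symm
      have j2 : i2 = 2 := hinj (hi2.trans (one_mul _)).symm
      have j3 : i3 = 3 := hinj (hi3.trans (one_mul _)).symm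
      have j4 : i4 = 4 := hinj (hi4.trans (one_mul _)).symm
      subst j1 j2 j3 j4
      have q12 : b' 1 * b' 2 = b' 0 := by
        simp [hb', Table.basis_mul, pairsTwo_prod, pairsProd, e]
      have q34 : b' 3 * b' 4 = b' 0 := by
        simp [hb', Table.basis_mul, pairsTwo_prod, pairsProd, e]
      have q32 : b' 3 * b' 2 = α' • b' 1 := by
        simp [hb', Table.basis_mul, Fin.sum_univ_five, pairsTwo_prod, pairsProd, e]
      have q23 : b' 2 * b' 3 = β' • b' 1 := by
        simp [hb', Table.basis_mul, Fin.sum_univ_five, pairsTwo_prod, pairsProd, e]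
      have q22 : b' 2 * b' 2 = γ' • b' 4 := by
        simp [hb', Table.basis_mul, Fin.sum_univ_five, pairsTwo_prod, pairsProd, e]
      rw [smul_mul_smul_comm, q12] at e12
      rw [smul_mul_smul_comm, q34] at e34
      rw [smul_mul_smul_comm, q32, smul_smul, smul_smul] at e32
      rw [smul_mul_smul_comm, q23, smul_smul, smul_smul] at e23
      rw [smul_mul_smul_comm, q22, smul_smul, smul_smul] at e22
      have r12 := Table.smul_basis_inj _ _ e12
      have r34 := Table.smul_basis_inj _ _ e34
      have r32 := Table.smul_basis_inj _ _ e32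
      have r23 := Table.smul_basis_inj _ _ e23
      have r22 := Table.smul_basis_inj _ _ e22
      refine ⟨s1 ^ 2 * s4, mul_ne_zero (pow_ne_zero 2 hs1) hs4, ?_⟩
      simp only [Prod.smul_mk, smul_eq_mul, Prod.mk.injEq]
      refine ⟨?_, ?_, ?_⟩
      · linear_combination s1 * s4 * r32 - α' * s3 * s4 * r12 - α' * r34
      · linear_combination s1 * s4 * r23 - β' * s3 * s4 * r12 - β' * r34
      · linear_combination s1 ^ 2 * r22 - γ' * (s1 * s2 + 1) * r12
    · exfalso
      have j1 : i1 = 2 := hinj <| by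
        change (1 : ℂ) = _ at hi1
        change _ = (-1 : ℂ)
        linear_combination hi1
      have j2 : i2 = 1 := hinj <| by
        change (-1 : ℂ) = _ at hi2
        change _ = (1 : ℂ)
        linear_combination hi2
      have j3 : i3 = 4 := hinj <| by
        change (2 : ℂ) = _ at hi3
        change _ = (-2 : ℂ)
        linear_combination hi3
      have j4 : i4 = 3 := hinj <| by
        change (-2 : ℂ) = _ at hi4
        change _ = (2 : ℂ)
        linear_combination hi4
      subst j1 j2 j3 j4
      have q41 : b' 4 * b' 1 = 0 := by
        simp [hb', Table.basis_mul, pairsTwo_prod, pairsProd, e]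
      have q14 : b' 1 * b' 4 = 0 := by
        simp [hb', Table.basis_mul, pairsTwo_prod, pairsProd, e]
      have q11 : b' 1 * b' 1 = 0 := by
        simp [hb', Table.basis_mul, pairsTwo_prod, pairsProd, e]
      rw [smul_mul_smul_comm, q41, smul_zero, smul_smul, eq_comm, smul_eq_zero] at e32
      rw [smul_mul_smul_comm, q14, smul_zero, smul_smul, eq_comm, smul_eq_zero] at e23
      rw [smul_mul_smul_comm, q11, smul_zero, smul_smul, eq_comm, smul_eq_zero] at e22
      have r32 := e32.resolve_right (b'.ne_zero _)
      have r23 := e23.resolve_right (b'.ne_zero _)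
      have r22 := e22.resolve_right (b'.ne_zero _)
      apply h0
      simp only [Prod.mk_eq_zero]
      exact ⟨(mul_eq_zero.1 r32).resolve_right hs1, (mul_eq_zero.1 r23).resolve_right hs1,
        (mul_eq_zero.1 r22).resolve_right hs4⟩
  · rintro ⟨c, hc, hcc⟩
    simp only [Prod.smul_mk, smul_eq_mul, Prod.mk.injEq] at hcc
    obtain ⟨rfl, rfl, rfl⟩ := hcc
    exact iso_pairsTwo_smul hc h h'

theorem basis_mul_pairs_eq_smul_basis_zero (l : ℂ) {i j : Fin 5} (hi : i ≠ 0) (hj : j ≠ 0) :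
    ∃ r : ℂ, (pairs l).basis i * (pairs l).basis j = r • (pairs l).basis 0 := by
  fin_cases i <;> fin_cases j <;> simp at hi hj <;>
    simp [Table.basis_mul, pairs_prod, pairsProd, e] <;>
    first | exact ⟨0, (zero_smul ℂ _).symm⟩ | exact ⟨1, (one_smul ℂ _).symm⟩

theorem not_iso_pairs_pairsTwo {l α β γ : ℂ} (h : 2 * α = β + γ) (hl0 : l ≠ 0) (hl1 : l ≠ 1)
    (hl2 : l ≠ -1) (h0 : (α, β, γ) ≠ 0) :
    ¬ Iso (pairs l).Alg (pairsTwo α β γ h).Alg := by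
  intro hiso
  obtain ⟨f, hf⟩ := hiso.symm
  obtain ⟨k, hk, hk0, hs⟩ := (isGraded_pairsTwo h).exists_scale
    (isGraded_of_prod_eq_pairsProd hl0 hl1 hl2 (T := pairs l) rfl) hf
  set b := (pairsTwo α β γ h).basis with hb
  have hs' : ∀ i, i ≠ 0 → ∃ j, j ≠ 0 ∧ ∃ s : ℂ, s ≠ 0 ∧ f (b i) = s • (pairs l).basis j := by
    intro i hi
    obtain ⟨j, s, hs, hfi, hij⟩ := hs i
    refine ⟨j, ?_, s, hs, hfi⟩
    rintro rfl
    refine hi ((isGraded_pairsTwo h).injective (hij.trans ?_))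
    simp
  have key : ∀ i j k : Fin 5, i ≠ 0 → j ≠ 0 → k ≠ 0 → ∀ r : ℂ, b i * b j = r • b k → r = 0 := by
    intro i j m hi hj hm r hr
    obtain ⟨i', hi', s, -, hsi⟩ := hs' i hi
    obtain ⟨j', hj', t, -, htj⟩ := hs' j hj
    obtain ⟨m', hm', u, hu, hum⟩ := hs' m hm
    obtain ⟨q, hq⟩ := basis_mul_pairs_eq_smul_basis_zero l hi' hj'
    have h1 := congrArg f hr
    rw [hf, hsi, htj, smul_mul_smul_comm, hq, map_smul, hum, smul_smul, smul_smul] at h1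
    have h2 := congrArg (fun z => (pairs l).basis.repr z m') h1
    simp [hm'.symm, hu] at h2
    exact h2
  apply h0
  simp only [Prod.mk_eq_zero]
  refine ⟨key 3 2 1 (by decide) (by decide) (by decide) α ?_,
    key 2 3 1 (by decide) (by decide) (by decide) β ?_,
    key 2 2 4 (by decide) (by decide) (by decide) γ ?_⟩ <;>
  simp [hb, Table.basis_mul, Fin.sum_univ_five, pairsTwo_prod, pairsProd, e]

theorem not_iso_chain_of_prod_eq_pairsProd {l α β γ : ℂ} (hl0 : l ≠ 0) (hl1 : l ≠ 1)
    (hl2 : l ≠ -1) {T : Table 5} (hT : T.prod = pairsProd l α β γ) :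
    ¬ Iso T.Alg chain.Alg := by
  rintro ⟨f, hf⟩
  obtain ⟨k, hk, -, hs⟩ := (isGraded_of_prod_eq_pairsProd hl0 hl1 hl2 hT).exists_scale
    isGraded_chain hf
  obtain ⟨i1, -, -, -, h1⟩ := hs 1
  obtain ⟨i2, -, -, -, h2⟩ := hs 2
  obtain ⟨i3, -, -, -, h3⟩ := hs 3
  obtain ⟨i4, -, -, -, h4⟩ := hs 4
  have key : ∀ i j : Fin 5, ∀ r : ℂ, r ≠ 0 → r = k * (![0, -1, 1, 2, 3] : Fin 5 → ℂ) i →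
      -r = k * (![0, -1, 1, 2, 3] : Fin 5 → ℂ) j → r = k ∨ r = -k := by
    intro i j r hr hi hj
    fin_cases i <;> fin_cases j <;> simp at hi hj <;> grind
  have e1 := key i1 i2 1 one_ne_zero h1 h2
  have e2 := key i3 i4 l hl0 h3 h4
  grind

end Isomorphisms

end LSA

theorem mainTheorem5 :
    -- dimension 2
    (∀ (A : Type u) [LeftPreLieRing A] [LeftPreLieAlgebra ℂ A] [FiniteDimensional ℂ A],
      LSA.IsSimpleCompleteOneDim A → Module.finrank ℂ A ≠ 2) ∧
    -- dimension 3
    (LSA.IsSimpleCompleteOneDim LSA.auslander.Alg ∧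
      Module.finrank ℂ LSA.auslander.Alg = 3 ∧
      ∀ (A : Type u) [LeftPreLieRing A] [LeftPreLieAlgebra ℂ A] [FiniteDimensional ℂ A],
        LSA.IsSimpleCompleteOneDim A → Module.finrank ℂ A = 3 →
          LSA.Iso A LSA.auslander.Alg) ∧
    -- dimension 4
    (LSA.IsSimpleCompleteOneDim LSA.dimFour.Alg ∧
      Module.finrank ℂ LSA.dimFour.Alg = 4 ∧
      ∀ (A : Type u) [LeftPreLieRing A] [LeftPreLieAlgebra ℂ A] [FiniteDimensional ℂ A],
        LSA.IsSimpleCompleteOneDim A → Module.finrank ℂ A = 4 →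
          LSA.Iso A LSA.dimFour.Alg) ∧
    -- dimension 5: the algebras in the list
    (∀ l : ℂ, l ≠ 0 → l ≠ 1 → l ≠ -1 →
      LSA.IsSimpleCompleteOneDim (LSA.pairs l).Alg ∧
      Module.finrank ℂ (LSA.pairs l).Alg = 5) ∧
    (∀ (α β γ : ℂ) (h : 2 * α = β + γ), (α, β, γ) ≠ 0 →
      LSA.IsSimpleCompleteOneDim (LSA.pairsTwo α β γ h).Alg ∧
      Module.finrank ℂ (LSA.pairsTwo α β γ h).Alg = 5) ∧
    (LSA.IsSimpleCompleteOneDim LSA.chain.Alg ∧ Module.finrank ℂ LSA.chain.Alg = 5) ∧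
    -- dimension 5: the list is exhaustive
    (∀ (A : Type u) [LeftPreLieRing A] [LeftPreLieAlgebra ℂ A] [FiniteDimensional ℂ A],
      LSA.IsSimpleCompleteOneDim A → Module.finrank ℂ A = 5 →
        (∃ l : ℂ, 1 ≤ ‖l‖ ∧ l ≠ 1 ∧ l ≠ -1 ∧ LSA.Iso A (LSA.pairs l).Alg) ∨
        (∃ (α β γ : ℂ) (h : 2 * α = β + γ), (α, β, γ) ≠ 0 ∧
          LSA.Iso A (LSA.pairsTwo α β γ h).Alg) ∨
        LSA.Iso A LSA.chain.Alg) ∧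
    -- dimension 5: isomorphisms inside the families
    (∀ l m : ℂ, l ≠ 0 → l ≠ 1 → l ≠ -1 → m ≠ 0 → m ≠ 1 → m ≠ -1 →
      (LSA.Iso (LSA.pairs l).Alg (LSA.pairs m).Alg ↔
        m = l ∨ m = -l ∨ m = l⁻¹ ∨ m = -l⁻¹)) ∧
    (∀ (α β γ α' β' γ' : ℂ) (h : 2 * α = β + γ) (h' : 2 * α' = β' + γ'),
      (α, β, γ) ≠ 0 → (α', β', γ') ≠ 0 →
      (LSA.Iso (LSA.pairsTwo α β γ h).Alg (LSA.pairsTwo α' β' γ' h').Alg ↔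
        ∃ c : ℂ, c ≠ 0 ∧ (α', β', γ') = c • (α, β, γ))) ∧
    -- dimension 5: no isomorphisms between different families
    (∀ (l α β γ : ℂ) (h : 2 * α = β + γ), l ≠ 0 → l ≠ 1 → l ≠ -1 → (α, β, γ) ≠ 0 →
      ¬ LSA.Iso (LSA.pairs l).Alg (LSA.pairsTwo α β γ h).Alg) ∧
    (∀ l : ℂ, l ≠ 0 → l ≠ 1 → l ≠ -1 → ¬ LSA.Iso (LSA.pairs l).Alg LSA.chain.Alg) ∧
    (∀ (α β γ : ℂ) (h : 2 * α = β + γ), (α, β, γ) ≠ 0 →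
      ¬ LSA.Iso (LSA.pairsTwo α β γ h).Alg LSA.chain.Alg) := by
  refine ⟨fun A _ _ _ h => LSA.finrank_ne_two h.simple h.oneDim,
    ⟨LSA.isSimpleCompleteOneDim_auslander, LSA.Table.finrank_alg _,
      fun A _ _ _ h hd => LSA.iso_auslander h.simple h.oneDim hd⟩,
    ⟨LSA.isSimpleCompleteOneDim_dimFour, LSA.Table.finrank_alg _,
      fun A _ _ _ h hd => LSA.iso_dimFour h.simple h.oneDim hd⟩,
    fun l h0 h1 h2 => ⟨LSA.isSimpleCompleteOneDim_of_prod_eq_pairsProd h0 h1 h2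
      (T := LSA.pairs l) rfl, LSA.Table.finrank_alg _⟩,
    fun α β γ h _ => ⟨LSA.isSimpleCompleteOneDim_of_prod_eq_pairsProd (l := 2) two_ne_zero
      (by norm_num) (by norm_num) (T := LSA.pairsTwo α β γ h) rfl, LSA.Table.finrank_alg _⟩,
    ⟨LSA.isSimpleCompleteOneDim_chain, LSA.Table.finrank_alg _⟩,
    fun A _ _ _ h hd => LSA.isListedFive h.simple h.oneDim hd,
    fun l m hl0 hl1 hl2 hm0 hm1 hm2 => LSA.iso_pairs_iff hl0 hl1 hl2 hm0 hm1 hm2,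
    fun α β γ α' β' γ' h h' h0 _ => LSA.iso_pairsTwo_iff h h' h0,
    fun l α β γ h hl0 hl1 hl2 h0 => LSA.not_iso_pairs_pairsTwo h hl0 hl1 hl2 h0,
    fun l hl0 hl1 hl2 => LSA.not_iso_chain_of_prod_eq_pairsProd hl0 hl1 hl2
      (T := LSA.pairs l) rfl,
    fun α β γ h _ => LSA.not_iso_chain_of_prod_eq_pairsProd (l := 2) two_ne_zero
      (by norm_num) (by norm_num) (T := LSA.pairsTwo α β γ h) rfl⟩
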